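/- Let $k\ge 1$, $d\ge 1$. Let $F_\rho=\{0\}\times\mathbb{R}^{k-d}\subseteq\mathbb{R}^k$ and identify $\mathbb{R}^d$ with $\langle e_1,\dots,e_d\rangle\subseteq\mathbb{R}^k$. Let $E\subseteq\mathbb{R}^k$ be a $d$-dimensional subspace complementary to $F_\rho$, let $F_\pi$ be another complement of $E$, and let $\pi$ be the projection onto $E$ along $F_\pi$, where $\pi|_{\mathbb{Z}^k}$ is assumed injective. Let $\rho$ and $\rho^*$ be the projections onto $E$ and $F_\rho$ in the decomposition $\mathbb{R}^k=E+F_\rho$. For $\mathcal{W}_\pi\subseteq F_\pi$, $\mathcal{S}=\mathcal{W}_\pi+E$ and $s\in\mathbb{R}^k/\mathbb{Z}^k$, the set $Y=\pi(\mathcal{S}\cap(\mathbb{Z}^k+s))$ is called a $k$ to $d$ cut and project set. It is *canonical* if $\mathbb{Z}^k+s$ does not meet $\partial\mathcal{S}$, the image of $E$ in $\mathbb{R}^k/\mathbb{Z}^k$ is dense, the only $x\in E$ with $Y+x=Y$ is $x=0$, and the window $\mathcal{S}\cap F_\rho$ equals $\rho^*([0,1]^k)$. For $y\in Y$ let $\tilde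 y\in\mathbb{Z}^k$ be the point with $\pi(\tilde y+s)=y$. For $\Omega\subseteq\mathbb{R}^d$ the patch of shape $\Omega$ at $y$ is $P(y,\Omega)=\{y'\in Y:\rho(\tilde y'-\tilde y)\in\rho(\Omega)\}$; the patches at $y_1,y_2$ are equivalent if $P(y_1,\Omega)=P(y_2,\Omega)+y_1-y_2$. The pattern of shape $\Omega$ at $y$ occurs in $B\subseteq\mathbb{R}^d$ if there is $y'\in Y\cap\rho(B)$ such that $P(y',\Omega)$ and $P(y,\Omega)$ are equivalent. Let $\mathcal{R}_d$ be the collection of rectangles $\prod_{i=1}^d[a_i,b_i]$ with $a_i<b_i$ integers and $a_i\le 0\le b_i$. We say that $Y$ is $\mathrm{LR}$ (respectively $\mathrm{LR}_\Omega$) with respect to $\mathcal{R}_d$ if there is a constant $C>0$ such that, for every $\Omega\in\mathcal{R}_d$, every pattern of shape $\Omega$ in $Y$ occurs in every ball of volume $C|\Omega|$ (respectively in every translate of $C\Omega$) in $\mathbb{R}^d$. Write $\|x\|$ for the distance from $x\in\mathbb{R}$ to the nearest integer. The Littlewood conjecture is the assertion that $\liminf_{n\to\infty}n\|n\alpha\|\|n\beta\|=0$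 for all $\alpha,\beta\in\mathbb{R}$. **Theorem.** 1. Let $k>d\ge1$. If $k-d>1$, there are no $k$ to $d$ canonical cut and project sets which are $\mathrm{LR}$ with respect to $\mathcal{R}_d$. If $k-d=1$, the following are equivalent: (C1) there exists a $k$ to $d$ canonical cut and project set which is $\mathrm{LR}$ with respect to $\mathcal{R}_d$; (C2) there exist real numbers $\alpha_1,\dots,\alpha_d$ with $\liminf_{n\to\infty}n\|n\alpha_1\|\cdots\|n\alpha_d\|>0$. 2. If the Littlewood conjecture is true then, for all $k$ and all $d\ge 1$ with $(k,d)\ne(2,1)$, there are no $k$ to $d$ canonical cut and project sets which are $\mathrm{LR}$ with respect to $\mathcal{R}_d$. 3. If the Littlewood conjecture is true then, for all $d\ge1$ and all $k\ne 2d$, there are no $k$ to $d$ canonical cut and project sets which are $\mathrm{LR}_\Omega$ with respect to $\mathcal{R}_d$. -/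

import Mathlib

open scoped Pointwise

noncomputable section

/-- The space `ℝᵐ` with its Euclidean structure. -/
abbrev RSpace (m : ℕ) : Type := EuclideanSpace ℝ (Fin m)

/-- The lattice `ℤᵏ ⊆ ℝᵏ`. -/
def intLattice (k : ℕ) : AddSubgroup (RSpace k) where
  carrier := {x | ∀ i, ∃ n : ℤ, x i = n}
  zero_mem' := fun _ => ⟨0, by simp⟩
  add_mem' := by
    intro x y hx hy i
    obtain ⟨a, ha⟩ := hx i
    obtain ⟨b, hb⟩ := hy i
    exact ⟨a + b, by simp [ha, hb]⟩
  neg_mem' := by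
    intro x hx i
    obtain ⟨a, ha⟩ := hx i
    exact ⟨-a, by simp [ha]⟩

/-- The reference subspace `F_ρ = {0} × ℝᵏ⁻ᵈ` of `ℝᵏ`. -/
def refSubspace (k d : ℕ) : Submodule ℝ (RSpace k) where
  carrier := {x | ∀ i : Fin k, i.val < d → x i = 0}
  zero_mem' := fun _ _ => by simp
  add_mem' := by
    intro x y hx hy i hi
    simp [hx i hi, hy i hi]
  smul_mem' := by
    intro c x hx i hi
    simp [hx i hi]

/-- The identification of `ℝᵈ` with the coordinate plane `⟨e₁, …, e_d⟩ ⊆ ℝᵏ`. -/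
def embedCoord (k d : ℕ) (x : RSpace d) : RSpace k :=
  WithLp.toLp 2 fun i => if h : i.val < d then x ⟨i.val, h⟩ else 0

/-- The closed unit cube in `ℝᵏ`. -/
def unitCube (k : ℕ) : Set (RSpace k) := {x | ∀ i, 0 ≤ x i ∧ x i ≤ 1}

/-- The data defining a `k` to `d` cut and project set: the physical space `E`, the complementary
space `F_π`, the window `W_π ⊆ F_π` and the translation parameter `s` (a representative of a
point of `ℝᵏ / ℤᵏ`). The standing conventions are that `E` is also complementary to `F_ρ`, i.e.
`E` is the graph of a linear map `ℝᵈ → ℝᵏ⁻ᵈ`, and that the projection to `E` along `F_π` is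
injective on `ℤᵏ`. -/
structure CutProject (k d : ℕ) where
  E : Submodule ℝ (RSpace k)
  Fπ : Submodule ℝ (RSpace k)
  Wπ : Set (RSpace k)
  s : RSpace k
  finrank_E : Module.finrank ℝ E = d
  compl_pi : IsCompl E Fπ
  compl_rho : IsCompl E (refSubspace k d)
  window_subset : Wπ ⊆ Fπ
  injOn_pi : Set.InjOn (E.projection Fπ compl_pi) (intLattice k : Set (RSpace k))

namespace CutProject

variable {k d : ℕ} (D : CutProject k d)

/-- The projection onto `E` along `F_π`. -/
def π : RSpace k →ₗ[ℝ] RSpace k := D.E.projection D.Fπ D.compl_pi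

/-- The projection onto `E` along `F_ρ`. -/
def ρ : RSpace k →ₗ[ℝ] RSpace k := D.E.projection (refSubspace k d) D.compl_rho

/-- The projection onto `F_ρ` along `E`. -/
def ρstar : RSpace k →ₗ[ℝ] RSpace k := (refSubspace k d).projection D.E D.compl_rho.symm

/-- The strip `S = W_π + E`. -/
def strip : Set (RSpace k) := D.Wπ + (D.E : Set (RSpace k))

/-- The window in the reference subspace, `W = S ∩ F_ρ`. -/
def window : Set (RSpace k) := D.strip ∩ (refSubspace k d : Set (RSpace k))

/-- The cut and project set `Y_s = π (S ∩ (ℤᵏ + s))`. -/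
def Y : Set (RSpace k) := D.π '' (D.strip ∩ {z | ∃ n ∈ intLattice k, z = n + D.s})

/-- `s` is a regular point: `ℤᵏ + s` does not meet the boundary of the strip. -/
def IsRegular : Prop := ∀ n ∈ intLattice k, n + D.s ∉ frontier D.strip

/-- The image of `E` in the torus `ℝᵏ / ℤᵏ` is dense. -/
def IsTotallyIrrational : Prop :=
  Dense ((QuotientAddGroup.mk : RSpace k → RSpace k ⧸ intLattice k) '' (D.E : Set (RSpace k)))

/-- The only `x ∈ E` with `Y + x = Y` is `0`. -/
def IsAperiodic : Prop := ∀ x ∈ D.E, (fun y => y + x) '' D.Y = D.Y → x = 0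

/-- A canonical cut and project set: regular, totally irrational, aperiodic, and the window `W`
is the image under `ρ*` of the unit cube. -/
def IsCanonical : Prop :=
  D.IsRegular ∧ D.IsTotallyIrrational ∧ D.IsAperiodic ∧ D.window = D.ρstar '' unitCube k

/-- The subset of `E` corresponding to a subset of `ℝᵈ`, namely its image under `ρ`. -/
def toE (B : Set (RSpace d)) : Set (RSpace k) := D.ρ '' (embedCoord k d '' B)

/-- The patch of shape `Ω` at `y`. Here `n` and `n'` are the lattice points `ỹ` and `ỹ'` above
`y` and `y'`, which are unique because `π` is injective on `ℤᵏ`. -/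
def patch (y : RSpace k) (Ω : Set (RSpace d)) : Set (RSpace k) :=
  {y' | y' ∈ D.Y ∧ ∃ n ∈ intLattice k, ∃ n' ∈ intLattice k,
    D.π (n + D.s) = y ∧ D.π (n' + D.s) = y' ∧ D.ρ (n' - n) ∈ D.toE Ω}

/-- Equivalence of the patches of shape `Ω` at `y₁` and `y₂`. -/
def PatchEquiv (Ω : Set (RSpace d)) (y₁ y₂ : RSpace k) : Prop :=
  D.patch y₁ Ω = (fun z => z + (y₁ - y₂)) '' D.patch y₂ Ω

/-- The pattern of shape `Ω` found at `y` occurs in the region `B ⊆ ℝᵈ`: the region contains the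
distinguished point of an equivalent patch. -/
def OccursIn (Ω : Set (RSpace d)) (y : RSpace k) (B : Set (RSpace d)) : Prop :=
  ∃ y' ∈ D.Y, y' ∈ D.toE B ∧ D.PatchEquiv Ω y' y

/-- `Y` is LR with respect to `A`: patterns of shape `Ω ∈ A` occur in every ball of volume
`C |Ω|`. -/
def IsLR (A : Set (Set (RSpace d))) : Prop :=
  ∃ C : ℝ, 0 < C ∧ ∀ Ω ∈ A, ∀ y ∈ D.Y, ∀ (x : RSpace d) (r : ℝ),
    MeasureTheory.volume (Metric.ball x r) = ENNReal.ofReal C * MeasureTheory.volume Ω →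
      D.OccursIn Ω y (Metric.ball x r)

/-- `Y` is LR_Ω with respect to `A`: patterns of shape `Ω ∈ A` occur in every translate of
`C Ω`. -/
def IsLROmega (A : Set (Set (RSpace d))) : Prop :=
  ∃ C : ℝ, 0 < C ∧ ∀ Ω ∈ A, ∀ y ∈ D.Y, ∀ x : RSpace d,
    D.OccursIn Ω y ((fun z => x + C • z) '' Ω)

end CutProject

/-- The collection of aligned rectangles in `ℝᵈ` with non-empty interior and integer vertices
that contain the origin, which is the position of the distinguished point of a patch. -/
def alignedBoxes (d : ℕ) : Set (Set (RSpace d)) :=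
  {Ω | ∃ a b : Fin d → ℤ, (∀ i, a i < b i) ∧ (∀ i, a i ≤ 0 ∧ 0 ≤ b i) ∧
    Ω = {x | ∀ i, (a i : ℝ) ≤ x i ∧ x i ≤ (b i : ℝ)}}

/-- Distance to the nearest integer. -/
def distInt (x : ℝ) : ℝ := |x - round x|

/-- `liminf n ‖n α₁‖ ⋯ ‖n α_m‖` as `n → ∞`, in the extended reals. -/
def littlewoodLiminf {m : ℕ} (α : Fin m → ℝ) : EReal :=
  Filter.liminf (fun n : ℕ => (((n : ℝ) * ∏ i, distInt ((n : ℝ) * α i) : ℝ) : EReal))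
    Filter.atTop

/-- The Littlewood conjecture. -/
def LittlewoodConjecture : Prop := ∀ α β : ℝ, littlewoodLiminf ![α, β] = 0

end

/-! `E` is the graph of `k - d` linear forms `L_i` in `d` variables (`CutProject.form`). Membership
in the strip depends only on `ρ*`, whose coordinates at `z` with index `i ≥ d` are `z_i - L_i(head
z)` (`ρstar_apply`). A patch of shape `Ω` therefore codes the forms at the integer points of `Ω`
(`floor_eq_of_equiv`), and repetitivity becomes a question of Diophantine approximation.

Necessity. Given distinct forms `L_i` and integer points `m_i` in `Ω` with no `L_i(m_i)` an integer,
some pattern of shape `Ω` occurs only when the values of the `L_i` at its centre lie in a torus box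
of volume `∏ ‖L_i(m_i)‖`. If the pattern occurs in every translate of a region `B`, then translates
of this box by the values of the forms at integer points near `B` cover the torus
(`exists_covering_bound`). Counting those points gives `BoxBound`, that is `1 ≤ κ |Ω| ∏ ‖L_i(m_i)‖`.
For one form this is multiplicative bad approximability of a linear form. For two forms depending
irrationally on a common variable it contradicts Dirichlet's theorem (`BoxBound.eq_of_irrational`).

In codimension at least two some form is thus rational in one variable and takes only `O(R^(d-1))`
values modulo one on a ball of radius `R`, too few for a thin box of volume `R^d`
(`IsCanonical.not_isLR_of_lt`). In codimension one, `simultaneous_of_dual` passes from the form to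
the vector of its coefficients. Under the Littlewood conjecture, `BoxBound` leaves one irrational
coefficient in each row and each column of the coefficient matrix, so the matrix is square and `k =
2d` (`BoxBound.eq_two_mul`).

Sufficiency. A badly approximable vector gives a badly approximable form (`dual_of_simultaneous`).
For the resulting set of codimension one, the thresholds deciding a patch of shape `Ω` are separated
by a constant over `|Ω|`. The inhomogeneous transference `exists_inhomogeneous` reaches every
interval of that length from a ball of volume proportional to `|Ω|` (`codimOneSet_isLR`). -/

theorem distInt_nonneg (x : ℝ) : 0 ≤ distInt x := abs_nonneg _

theorem distInt_le_abs_sub (x : ℝ) (p : ℤ) : distInt x ≤ |x - p| := round_le x p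

theorem distInt_le_half (x : ℝ) : distInt x ≤ 1 / 2 := abs_sub_round x

theorem distInt_eq_zero_iff {x : ℝ} : distInt x = 0 ↔ ∃ p : ℤ, x = p := by
  constructor
  · intro h
    exact ⟨round x, sub_eq_zero.1 (abs_eq_zero.1 h)⟩
  · rintro ⟨p, rfl⟩
    simp [distInt]

theorem distInt_nat_mul_le (N : ℕ) (x : ℝ) : distInt (N * x) ≤ N * distInt x := by
  have h := distInt_le_abs_sub (N * x) (N * round x)
  push_cast at h
  rwa [← mul_sub, abs_mul, Nat.abs_cast] at h

/-! ### Transference principles for multiplicative Diophantine approximation. -/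

/-- If `α₁, …, α_d` are multiplicatively badly approximable then so is the dual linear form. -/
theorem dual_of_simultaneous {d : ℕ} (α : Fin d → ℝ) {c : ℝ} (hc : 0 < c)
    (h : ∀ n : ℕ, 1 ≤ n → c ≤ n * ∏ j, distInt (n * α j)) :
    ∃ c' : ℝ, 0 < c' ∧ ∀ m : Fin d → ℤ, m ≠ 0 → ∀ p : ℤ,
      c' ≤ |∑ j, α j * m j - p| * ∏ j, max 1 |(m j : ℝ)| := by
  -- The final estimate is `d / K + N η`; each summand gets half of `c`.
  obtain ⟨K, hK1, hK⟩ : ∃ K : ℕ, 1 ≤ K ∧ (d : ℝ) / K ≤ c / 2 := by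
    obtain ⟨K, hK⟩ := exists_nat_gt (2 * d / c)
    refine ⟨K + 1, by omega, ?_⟩
    rw [div_le_div_iff₀ (by positivity) (by norm_num)]
    rw [div_lt_iff₀ hc] at hK
    push_cast
    nlinarith
  have hK0 : (0 : ℝ) < K := by exact_mod_cast hK1
  refine ⟨c / (2 * K ^ d), by positivity, fun m hm p => ?_⟩
  by_contra hlt
  push Not at hlt
  set η := |∑ j, α j * m j - p| with hη
  have hη0 : 0 ≤ η := abs_nonneg _
  obtain ⟨j0, hj0⟩ : ∃ j, m j ≠ 0 := by
    by_contra hcon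
    push Not at hcon
    exact hm (funext hcon)
  -- Numbers of cells per coordinate. The coordinate `j0` is controlled by a congruence modulo `m
  -- j0` instead of a subdivision of the circle.
  set B : Fin d → ℤ := fun j => if j = j0 then |m j0| else K * max 1 |m j| with hB
  have hBpos : ∀ j, 0 < B j := by
    intro j
    simp only [hB]
    split_ifs
    · exact abs_pos.2 hj0
    · have : 0 < max 1 |m j| := lt_of_lt_of_le one_pos (le_max_left _ _)
      have : (0 : ℤ) < K := by exact_mod_cast hK1
      positivity
  have hBposR : ∀ j, (0 : ℝ) < B j := fun j => by exact_mod_cast hBpos j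
  have hBle : ∀ j, (B j : ℝ) ≤ K * max 1 |(m j : ℝ)| := by
    intro j
    simp only [hB]
    split_ifs with hj
    · subst hj
      push_cast
      have h1 : (1 : ℝ) ≤ K := by exact_mod_cast hK1
      have h2 : |(m j : ℝ)| ≤ max 1 |(m j : ℝ)| := le_max_right _ _
      nlinarith [abs_nonneg (m j : ℝ)]
    · push_cast
      exact le_rfl
  have hBge : ∀ j, j ≠ j0 → (K : ℝ) * |(m j : ℝ)| ≤ B j := by
    intro j hj
    simp only [hB, if_neg hj]
    push_cast
    exact mul_le_mul_of_nonneg_left (le_max_right _ _) hK0.le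
  set N : ℕ := (∏ j, B j).toNat with hN
  have hNB : (N : ℤ) = ∏ j, B j := Int.toNat_of_nonneg (Finset.prod_nonneg fun j _ => (hBpos j).le)
  have hNR : (N : ℝ) = ∏ j, (B j : ℝ) := by exact_mod_cast congrArg (Int.cast (R := ℝ)) hNB
  -- Pigeonhole of `N + 1` integers into `N` classes. The residue at `j0` ensures that the
  -- approximation of `n α_{j0}` forced by the small linear form is by an integer.
  set f : ℕ → Fin d → ℤ := fun n j =>
    if j = j0 then (p * n - ∑ i ∈ Finset.univ.erase j0, m i * ⌊n * α i⌋) % |m j0|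
    else ⌊B j * Int.fract (n * α j)⌋ with hf
  obtain ⟨n₁, h₁, n₂, h₂, hne, hff⟩ : ∃ n₁ ∈ Finset.range (N + 1), ∃ n₂ ∈ Finset.range (N + 1),
      n₁ ≠ n₂ ∧ f n₁ = f n₂ := by
    apply Finset.exists_ne_map_eq_of_card_lt_of_maps_to
      (t := Fintype.piFinset fun j => Finset.Ico (0 : ℤ) (B j))
    · rw [Fintype.card_piFinset, Finset.card_range]
      simp only [Int.card_Ico, sub_zero]
      have : ((∏ j, (B j).toNat : ℕ) : ℤ) = N := by
        rw [hNB]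
        push_cast
        exact Finset.prod_congr rfl fun j _ => Int.toNat_of_nonneg (hBpos j).le
      have := Int.natCast_inj.1 this
      omega
    · intro n _
      simp only [Finset.mem_coe, Fintype.mem_piFinset, Finset.mem_Ico]
      intro j
      simp only [hf]
      split_ifs with hj
      · refine ⟨Int.emod_nonneg _ (abs_ne_zero.2 hj0), ?_⟩
        have := Int.emod_lt_of_pos (p * n - ∑ i ∈ Finset.univ.erase j0, m i * ⌊n * α i⌋)
          (abs_pos.2 hj0)
        simpa [hB, hj] using this
      · constructor
        · exact Int.floor_nonneg.2 (mul_nonneg (hBposR j).le (Int.fract_nonneg _))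
        · rw [Int.floor_lt]
          calc (B j : ℝ) * Int.fract (n * α j) < B j * 1 :=
                mul_lt_mul_of_pos_left (Int.fract_lt_one _) (hBposR j)
            _ = B j := mul_one _
  wlog hlt12 : n₁ < n₂ generalizing n₁ n₂
  · exact this n₂ h₂ n₁ h₁ hne.symm hff.symm (by omega)
  set n := n₂ - n₁ with hn
  have hn1 : 1 ≤ n := by omega
  have hnN : (n : ℝ) ≤ N := by
    rw [Finset.mem_range] at h₂
    exact_mod_cast (by omega : n ≤ N)
  have hnR : (n : ℝ) = n₂ - n₁ := by rw [hn, Nat.cast_sub hlt12.le]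
  set ν : Fin d → ℤ := fun j => ⌊n₂ * α j⌋ - ⌊n₁ * α j⌋ with hν
  have hclose : ∀ j, j ≠ j0 → |n * α j - ν j| ≤ 1 / B j := by
    intro j hj
    have := congrFun hff j
    simp only [hf, if_neg hj] at this
    have h3 := Int.abs_sub_lt_one_of_floor_eq_floor this
    rw [← mul_sub, abs_mul, abs_of_pos (hBposR j)] at h3
    rw [le_div_iff₀ (hBposR j), mul_comm]
    have h4 : (n * α j - ν j : ℝ) = -(Int.fract (n₁ * α j) - Int.fract (n₂ * α j)) := by
      simp only [hν, hnR, Int.fract]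
      push_cast
      ring
    rw [h4, abs_neg]
    exact h3.le
  obtain ⟨ν0, hν0⟩ : ∃ ν0 : ℤ, p * n - ∑ i ∈ Finset.univ.erase j0, m i * ν i = m j0 * ν0 := by
    have := congrFun hff j0
    simp only [hf, if_true] at this
    have h4 := Int.ModEq.dvd this
    rw [abs_dvd] at h4
    obtain ⟨ν0, h5⟩ := h4
    refine ⟨ν0, ?_⟩
    rw [← h5]
    simp only [hν, mul_sub, Finset.sum_sub_distrib]
    have : (n : ℤ) = n₂ - n₁ := by omega
    rw [this]
    ring
  have hX : |n * α j0 - ν0| ≤ ((d : ℝ) / K + N * η) / B j0 := by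
    rw [le_div_iff₀ (hBposR j0)]
    -- Solving the small form for `α_{j0}` makes `n α_{j0}` close to `ν0`, with an error controlled
    -- by `η` and the other coordinates.
    have e1 : (m j0 : ℝ) * (n * α j0 - ν0) =
        n * (∑ j, α j * m j - p) - ∑ i ∈ Finset.univ.erase j0, m i * (n * α i - ν i) := by
      have h6 : (p * n - ∑ i ∈ Finset.univ.erase j0, m i * ν i : ℝ) = m j0 * ν0 := by
        exact_mod_cast hν0
      push_cast at h6
      have h7 := Finset.add_sum_erase Finset.univ (fun j => α j * (m j : ℝ)) (Finset.mem_univ j0)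
      rw [← h7]
      simp only [mul_sub, Finset.sum_sub_distrib, mul_add]
      have h8 : ∑ i ∈ Finset.univ.erase j0, (m i : ℝ) * (n * α i) =
          n * ∑ i ∈ Finset.univ.erase j0, α i * m i := by
        rw [Finset.mul_sum]
        exact Finset.sum_congr rfl fun i _ => by ring
      rw [h8]
      linarith
    have e2 : (B j0 : ℝ) = |(m j0 : ℝ)| := by simp [hB]
    rw [e2, mul_comm, ← abs_mul, e1]
    refine (abs_sub _ _).trans ?_
    rw [add_comm]
    apply add_le_add
    · refine (Finset.abs_sum_le_sum_abs _ _).trans ?_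
      calc ∑ i ∈ Finset.univ.erase j0, |(m i : ℝ) * (n * α i - ν i)|
          ≤ ∑ i ∈ Finset.univ.erase j0, 1 / (K : ℝ) := by
            apply Finset.sum_le_sum
            intro i hi
            have hi' := Finset.ne_of_mem_erase hi
            rw [abs_mul]
            calc |(m i : ℝ)| * |n * α i - ν i| ≤ |(m i : ℝ)| * (1 / B i) :=
                  mul_le_mul_of_nonneg_left (hclose i hi') (abs_nonneg _)
              _ ≤ 1 / K := by
                  rw [mul_one_div, div_le_div_iff₀ (hBposR i) hK0]
                  linarith [hBge i hi']
        _ ≤ d / K := by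
            rw [Finset.sum_const, nsmul_eq_mul, mul_one_div]
            apply div_le_div_of_nonneg_right _ hK0.le
            have := Finset.card_le_univ (Finset.univ.erase j0)
            rw [Fintype.card_fin] at this
            exact_mod_cast this
    · rw [abs_mul, Nat.abs_cast]
      exact mul_le_mul_of_nonneg_right hnN hη0
  have hprod : ∏ j, distInt (n * α j) ≤ ((d : ℝ) / K + N * η) / N := by
    rw [← Finset.mul_prod_erase Finset.univ _ (Finset.mem_univ j0)]
    have h8 : ∏ j ∈ Finset.univ.erase j0, distInt (n * α j) ≤
        ∏ j ∈ Finset.univ.erase j0, (1 / (B j : ℝ)) :=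
      Finset.prod_le_prod (fun j _ => distInt_nonneg _) fun j hj =>
        (distInt_le_abs_sub _ (ν j)).trans (hclose j (Finset.ne_of_mem_erase hj))
    refine (mul_le_mul ((distInt_le_abs_sub _ ν0).trans hX) h8
      (Finset.prod_nonneg fun j _ => distInt_nonneg _)
      (div_nonneg (by positivity) (hBposR j0).le)).trans (le_of_eq ?_)
    rw [hNR, ← Finset.mul_prod_erase Finset.univ (fun j => (B j : ℝ)) (Finset.mem_univ j0),
      Finset.prod_div_distrib, Finset.prod_const_one, div_mul_div_comm, mul_one]
  have hN0 : (0 : ℝ) < N := by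
    rw [hNR]
    exact Finset.prod_pos fun j _ => hBposR j
  have hNη : N * η < c / 2 := by
    have : (N : ℝ) ≤ K ^ d * ∏ j, max 1 |(m j : ℝ)| := by
      rw [hNR]
      calc ∏ j, (B j : ℝ) ≤ ∏ j, (K * max 1 |(m j : ℝ)|) :=
            Finset.prod_le_prod (fun j _ => (hBposR j).le) fun j _ => hBle j
        _ = _ := by rw [Finset.prod_mul_distrib, Finset.prod_const, Finset.card_univ,
              Fintype.card_fin]
    have h9 : (K : ℝ) ^ d * (η * ∏ j, max 1 |(m j : ℝ)|) < c / 2 := by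
      have := mul_lt_mul_of_pos_left hlt (pow_pos hK0 d)
      refine this.trans_eq ?_
      field_simp
    nlinarith [mul_le_mul_of_nonneg_right this hη0]
  have hfin : (n : ℝ) * ∏ j, distInt (n * α j) ≤ (d : ℝ) / K + N * η := by
    calc (n : ℝ) * ∏ j, distInt (n * α j) ≤ N * (((d : ℝ) / K + N * η) / N) :=
          mul_le_mul hnN hprod (Finset.prod_nonneg fun j _ => distInt_nonneg _) hN0.le
      _ = _ := by field_simp
  linarith [h n hn1]

/-- A box of side lengths `K j` with more than `n` points contains one with at most `2 n`. -/
theorem exists_prod_between {ι : Type*} [Fintype ι] [DecidableEq ι] (K : ι → ℕ) {n : ℕ}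
    (hn : 1 ≤ n) (hK : n < ∏ j, K j) :
    ∃ N : ι → ℕ, (∀ j, N j ≤ K j) ∧ n < ∏ j, N j ∧ ∏ j, N j ≤ 2 * n := by
  induction hS : ∑ j, K j using Nat.strong_induction_on generalizing K with
  | _ S ih =>
    by_cases hle : ∏ j, K j ≤ 2 * n
    · exact ⟨K, fun _ => le_rfl, hK, hle⟩
    · push Not at hle
      obtain ⟨j0, hj0⟩ : ∃ j, 2 ≤ K j := by
        by_contra hcon
        push Not at hcon
        have : ∏ j, K j ≤ ∏ _j : ι, 1 := Finset.prod_le_prod' fun j _ => by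
          have := hcon j
          omega
        simp at this
        omega
      have hprod := Finset.mul_prod_erase Finset.univ K (Finset.mem_univ j0)
      have hsum := Finset.add_sum_erase Finset.univ K (Finset.mem_univ j0)
      -- Shortening a side of length at least two by one keeps at least half of the product, so a
      -- product above `2 n` stays above `n`.
      set K' := Function.update K j0 (K j0 - 1) with hK'
      have hP : ∏ j, K' j = (K j0 - 1) * ∏ j ∈ Finset.univ.erase j0, K j := by
        rw [← Finset.mul_prod_erase Finset.univ K' (Finset.mem_univ j0)]
        congr 1
        · simp [hK']
        · exact Finset.prod_congr rfl fun j hj => by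
            simp [hK', Function.update_of_ne (Finset.ne_of_mem_erase hj)]
      have hQ : ∑ j, K' j = (K j0 - 1) + ∑ j ∈ Finset.univ.erase j0, K j := by
        rw [← Finset.add_sum_erase Finset.univ K' (Finset.mem_univ j0)]
        congr 1
        · simp [hK']
        · exact Finset.sum_congr rfl fun j hj => by
            simp [hK', Function.update_of_ne (Finset.ne_of_mem_erase hj)]
      obtain ⟨t, ht⟩ : ∃ t, K j0 = t + 2 := ⟨K j0 - 2, by omega⟩
      have hlt : n < ∏ j, K' j := by
        rw [hP, ht]
        rw [ht] at hprod
        have : t + 2 - 1 = t + 1 := by omega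
        rw [this]
        nlinarith
      obtain ⟨N, h1, h2, h3⟩ := ih _ (by omega) K' hlt rfl
      refine ⟨N, fun j => (h1 j).trans ?_, h2, h3⟩
      by_cases hj : j = j0
      · subst hj
        simp [hK']
      · simp [hK', Function.update_of_ne hj]

/-- If the linear form with coefficients `α₁, …, α_d` is multiplicatively badly approximable then
so are the numbers `α₁, …, α_d` simultaneously. -/
theorem simultaneous_of_dual {d : ℕ} (hd : 1 ≤ d) (α : Fin d → ℝ) {c : ℝ} (hc : 0 < c)
    (h : ∀ m : Fin d → ℤ, m ≠ 0 → ∀ p : ℤ,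
      c ≤ |∑ j, α j * m j - p| * ∏ j, max 1 |(m j : ℝ)|) :
    ∃ c' : ℝ, 0 < c' ∧ ∀ n : ℕ, 1 ≤ n → c' ≤ n * ∏ j, distInt (n * α j) := by
  have hd0 : (0 : ℝ) < d := by exact_mod_cast hd
  -- With this value the bounds `d τ / n` and `2 n` obtained below multiply to `c / 2`.
  set τ := c / (4 * d) with hτ
  have hτ0 : 0 < τ := by positivity
  refine ⟨τ ^ d, by positivity, fun n hn => ?_⟩
  have hn0 : (0 : ℝ) < n := by exact_mod_cast hn
  by_contra hlt
  push Not at hlt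
  have hξ0 : ∀ j, 0 < distInt (n * α j) := by
    intro j
    refine lt_of_le_of_ne (distInt_nonneg _) fun h0 => ?_
    obtain ⟨p, hp⟩ := distInt_eq_zero_iff.1 h0.symm
    have := h (Pi.single j (n : ℤ)) (by
      intro h1
      have := congrFun h1 j
      simp at this
      omega) p
    have e : ∑ i, α i * ((Pi.single j (n : ℤ) : Fin d → ℤ) i : ℝ) - p = 0 := by
      rw [Finset.sum_eq_single j]
      · simp [← hp, mul_comm]
      · intro i _ hi
        simp [hi]
      · simp
    rw [e] at this
    simp at this
    linarith
  set ξ : Fin d → ℝ := fun j => distInt (n * α j) with hξ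
  -- Sides as long as possible with `|m_j| ‖n α_j‖ ≤ τ` for `|m_j| < K j`. The assumed smallness of
  -- `n ∏ ‖n α_j‖` makes their product exceed `n`.
  set K : Fin d → ℕ := fun j => ⌊τ / ξ j⌋₊ + 1 with hK
  have hnK : n < ∏ j, K j := by
    have h1 : ∏ j, τ / ξ j ≤ ∏ j, (K j : ℝ) :=
      Finset.prod_le_prod (fun j _ => (div_pos hτ0 (hξ0 j)).le) fun j _ => by
        simp only [hK]
        push_cast
        exact (Nat.lt_floor_add_one _).le
    have h2 : (n : ℝ) < ∏ j, τ / ξ j := by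
      rw [Finset.prod_div_distrib, Finset.prod_const, Finset.card_univ, Fintype.card_fin,
        lt_div_iff₀ (Finset.prod_pos fun j _ => hξ0 j)]
      exact hlt
    exact_mod_cast h2.trans_le h1
  -- The box is trimmed to at most `2 n` points: large enough for pigeonhole modulo `n`, small
  -- enough to bound `∏ max 1 |m_j|`.
  obtain ⟨N, hNK, hNn, hN2⟩ := exists_prod_between K hn hnK
  have hNpos : ∀ j, 1 ≤ N j := by
    intro j
    by_contra hcon
    have : N j = 0 := by omega
    have := Finset.prod_eq_zero (Finset.mem_univ j) this
    omega
  set ν : Fin d → ℤ := fun j => round (n * α j) with hν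
  obtain ⟨m₁, h₁, m₂, h₂, hne, hmod⟩ : ∃ m₁ ∈ Fintype.piFinset fun j => Finset.range (N j),
      ∃ m₂ ∈ Fintype.piFinset fun j => Finset.range (N j), m₁ ≠ m₂ ∧
      (∑ j, (m₁ j : ℤ) * ν j) % n = (∑ j, (m₂ j : ℤ) * ν j) % n := by
    apply Finset.exists_ne_map_eq_of_card_lt_of_maps_to (t := Finset.Ico (0 : ℤ) n)
      (f := fun m : Fin d → ℕ => (∑ j, (m j : ℤ) * ν j) % n)
    · simpa [Fintype.card_piFinset] using hNn
    · intro m _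
      simp only [Finset.coe_Ico, Set.mem_Ico]
      have : (0 : ℤ) < n := by exact_mod_cast hn
      exact ⟨Int.emod_nonneg _ this.ne', Int.emod_lt_of_pos _ this⟩
  set m : Fin d → ℤ := fun j => m₂ j - m₁ j with hm
  have hm0 : m ≠ 0 := by
    intro h0
    apply hne
    funext j
    have := congrFun h0 j
    simp only [hm, Pi.zero_apply] at this
    omega
  have habs : ∀ j, |(m j : ℝ)| ≤ N j - 1 := by
    intro j
    have a := Finset.mem_range.1 (Fintype.mem_piFinset.1 h₁ j)
    have b := Finset.mem_range.1 (Fintype.mem_piFinset.1 h₂ j)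
    have : |m j| ≤ (N j : ℤ) - 1 := by
      rw [abs_le]
      simp only [hm]
      omega
    exact_mod_cast this
  obtain ⟨p, hp⟩ : ∃ p : ℤ, ∑ j, m j * ν j = n * p := by
    obtain ⟨p, hp⟩ := Int.ModEq.dvd (show _ ≡ _ [ZMOD n] from hmod)
    refine ⟨p, ?_⟩
    rw [← hp]
    simp only [hm, sub_mul, Finset.sum_sub_distrib]
  have hsmall : |∑ j, α j * m j - p| ≤ d * τ / n := by
    rw [le_div_iff₀ hn0]
    have e : (∑ j, α j * m j - p) * n = ∑ j, m j * (n * α j - ν j) := by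
      have : ∑ j, (m j : ℝ) * ν j = n * p := by exact_mod_cast hp
      simp only [mul_sub, Finset.sum_sub_distrib, this, sub_mul, Finset.sum_mul]
      congr 1
      · exact Finset.sum_congr rfl fun j _ => by ring
      · ring
    rw [← abs_of_pos hn0, ← abs_mul, e]
    refine (Finset.abs_sum_le_sum_abs _ _).trans ?_
    calc ∑ j, |(m j : ℝ) * (n * α j - ν j)| ≤ ∑ _j : Fin d, τ := by
          apply Finset.sum_le_sum
          intro j _
          rw [abs_mul]
          change |(m j : ℝ)| * ξ j ≤ τ
          have h3 : (N j : ℝ) ≤ ⌊τ / ξ j⌋₊ + 1 := by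
            have := hNK j
            simp only [hK] at this
            exact_mod_cast this
          have h4 := Nat.floor_le (div_pos hτ0 (hξ0 j)).le
          rw [← le_div_iff₀ (hξ0 j)]
          linarith [habs j]
      _ = d * τ := by simp
  have hprod : ∏ j, max 1 |(m j : ℝ)| ≤ 2 * n := by
    calc ∏ j, max 1 |(m j : ℝ)| ≤ ∏ j, (N j : ℝ) :=
          Finset.prod_le_prod (fun j _ => le_max_of_le_left zero_le_one) fun j _ => by
            have : (1 : ℝ) ≤ N j := by exact_mod_cast hNpos j
            exact max_le this ((habs j).trans (by linarith))
      _ ≤ 2 * n := by exact_mod_cast hN2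
  have := (h m hm0 p).trans (mul_le_mul hsmall hprod
    (Finset.prod_nonneg fun j _ => le_max_of_le_left zero_le_one) (by positivity))
  have e : d * τ / n * (2 * n) = c / 2 := by
    rw [hτ]
    field_simp
    norm_num
  linarith

/-- The inhomogeneous transference principle for a badly approximable linear form. -/
theorem exists_inhomogeneous {d : ℕ} (α : Fin d → ℝ) {c : ℝ} (hc : 0 < c)
    (h : ∀ m : Fin d → ℤ, m ≠ 0 → ∀ p : ℤ,
      c ≤ |∑ j, α j * m j - p| * ∏ j, max 1 |(m j : ℝ)|) :
    ∃ t₀ : ℕ, ∀ R : ℕ, 1 ≤ R → ∀ γ : ℝ, ∃ (q : Fin d → ℤ) (p : ℤ),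
      (∀ j, |(q j : ℝ)| ≤ t₀ * R) ∧ |γ - (∑ j, α j * q j - p)| ≤ t₀ / (R : ℝ) ^ d := by
  wlog hc1 : c ≤ 1 generalizing c
  · exact this one_pos (fun m hm p => (not_le.1 hc1).le.trans (h m hm p)) le_rfl
  obtain ⟨M, hM⟩ := exists_nat_gt (2 / c)
  refine ⟨2 * M + 1, fun R hR γ => ?_⟩
  have hR0 : (0 : ℝ) < R := by exact_mod_cast hR
  have hR1 : (1 : ℝ) ≤ R := by exact_mod_cast hR
  set ε : ℝ := 1 / (R : ℝ) ^ d with hε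
  have hε0 : 0 < ε := by positivity
  -- `T t γ` grades the quality of approximation of `γ`. Levels add, and the set at level `s` widens
  -- by one step when its points are moved by an admissible vector.
  let T : ℕ → ℝ → Prop := fun t γ => ∃ (q : Fin d → ℤ) (p : ℤ),
    (∀ j, |(q j : ℝ)| ≤ t * R) ∧ |γ - (∑ j, α j * q j - p)| ≤ t * ε
  have hTmono : ∀ {s t : ℕ} {γ : ℝ}, s ≤ t → T s γ → T t γ := by
    rintro s t γ hst ⟨q, p, h1, h2⟩
    have : (s : ℝ) ≤ t := by exact_mod_cast hst
    exact ⟨q, p, fun j => (h1 j).trans (mul_le_mul_of_nonneg_right this hR0.le),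
      h2.trans (mul_le_mul_of_nonneg_right this hε0.le)⟩
  have hTstep : ∀ {s : ℕ} {γ γ' : ℝ} (q' : Fin d → ℤ) (p' : ℤ), (∀ j, |(q' j : ℝ)| ≤ R) →
      |γ' - γ - (∑ j, α j * q' j - p')| ≤ ε → T s γ → T (s + 1) γ' := by
    rintro s γ γ' q' p' h1 h2 ⟨q, p, h3, h4⟩
    refine ⟨q + q', p + p', fun j => ?_, ?_⟩
    · simp only [Pi.add_apply]
      push_cast
      refine (abs_add_le _ _).trans ?_
      linarith [h1 j, h3 j]
    · simp only [Pi.add_apply]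
      push_cast
      simp only [mul_add, Finset.sum_add_distrib]
      have := abs_add_le (γ - (∑ j, α j * q j - p)) (γ' - γ - (∑ j, α j * q' j - p'))
      refine le_trans (le_of_eq ?_) (this.trans ?_)
      · congr 1
        ring
      · linarith
  have hT0 : T 0 0 := ⟨0, 0, by simp, by simp⟩
  suffices hγ : T (2 * M + 1) (Int.fract γ) by
    obtain ⟨q, p, h1, h2⟩ := hγ
    refine ⟨q, p - ⌊γ⌋, h1, ?_⟩
    refine le_trans (le_of_eq ?_) (h2.trans (le_of_eq ?_))
    · congr 1
      rw [Int.fract]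
      push_cast
      ring
    · rw [hε, mul_one_div]
  by_contra hγ
  -- The bad value is rounded to the grid `ε ℤ`, at the cost of one level.
  set i₀ := ⌊Int.fract γ / ε⌋₊ with hi₀
  have hi₀T : ¬ T (2 * M) (i₀ * ε) := by
    intro hT
    apply hγ
    refine hTstep 0 0 (by simp) ?_ hT
    have h1 := Nat.floor_le (div_nonneg (Int.fract_nonneg γ) hε0.le)
    have h2 := Nat.lt_floor_add_one (Int.fract γ / ε)
    rw [le_div_iff₀ hε0] at h1
    rw [div_lt_iff₀ hε0] at h2
    simp only [Pi.zero_apply, Int.cast_zero, mul_zero, Finset.sum_const_zero, sub_zero]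
    rw [abs_le]
    constructor <;> nlinarith
  -- Take the first grid point that fails at level `2 s`: its predecessor succeeds there, and moving
  -- by `ε` costs only one level.
  have hex : ∀ s : ℕ, s < M → ∃ i : ℕ, T (2 * s + 1) (i * ε) ∧ ¬ T (2 * s) (i * ε) := by
    classical
    intro s hs
    have hP : ∃ i : ℕ, ¬ T (2 * s) (i * ε) := ⟨i₀, fun hT => hi₀T (hTmono (by omega) hT)⟩
    refine ⟨Nat.find hP, ?_, Nat.find_spec hP⟩
    rcases hfi : Nat.find hP with _ | i
    · exact hTmono (Nat.zero_le _) (by simpa using hT0)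
    · have h1 : T (2 * s) (i * ε) := not_not.1 (Nat.find_min hP (by omega : i < Nat.find hP))
      refine hTstep 0 0 (by simp) ?_ h1
      push_cast
      simp only [Pi.zero_apply, Int.cast_zero, mul_zero, Finset.sum_const_zero, sub_zero]
      rw [← sub_mul, add_sub_cancel_left, one_mul, abs_of_pos hε0]
  choose! i hi1 hi2 using hex
  -- These `M R^d` points lie in distinct cells of length `c ε` modulo one, which bounds `M` by
  -- about `2 / c`.
  set x : ℕ × (Fin d → ℕ) → ℝ := fun a => i a.1 * ε + ∑ j, α j * a.2 j with hx
  set S : Finset (ℕ × (Fin d → ℕ)) :=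
    Finset.range M ×ˢ Fintype.piFinset fun _ : Fin d => Finset.range R with hS
  have hcε : 0 < c * ε := mul_pos hc hε0
  have hRd1 : (1 : ℝ) ≤ (R : ℝ) ^ d := one_le_pow₀ hR1
  have hcard : S.card ≤ (Finset.range (⌊1 / (c * ε)⌋₊ + 1)).card := by
    apply Finset.card_le_card_of_injOn (fun a => ⌊Int.fract (x a) / (c * ε)⌋₊)
    · intro a _
      simp only [Finset.coe_range, Set.mem_Iio, Nat.lt_succ_iff]
      exact Nat.floor_le_floor (div_le_div_of_nonneg_right (Int.fract_lt_one _).le hcε.le)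
    · rintro ⟨s, q⟩ ha ⟨s', q'⟩ hb hab
      simp only [hS, Finset.coe_product, Set.mem_prod, Finset.mem_coe, Finset.mem_range,
        Fintype.mem_piFinset] at ha hb
      have hclose : |x (s, q) - x (s', q') - (⌊x (s, q)⌋ - ⌊x (s', q')⌋ : ℤ)| < c * ε := by
        have h1 := Nat.floor_le (div_nonneg (Int.fract_nonneg (x (s, q))) hcε.le)
        have h2 := Nat.lt_floor_add_one (Int.fract (x (s, q)) / (c * ε))
        have h3 := Nat.floor_le (div_nonneg (Int.fract_nonneg (x (s', q'))) hcε.le)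
        have h4 := Nat.lt_floor_add_one (Int.fract (x (s', q')) / (c * ε))
        simp only at hab
        rw [hab] at h1 h2
        rw [le_div_iff₀ hcε] at h1 h3
        rw [div_lt_iff₀ hcε] at h2 h4
        simp only [Int.fract] at h1 h2 h3 h4
        push_cast
        rw [abs_lt]
        constructor <;> nlinarith
      have hdiff : ∀ j, |(q j : ℝ) - q' j| ≤ R := by
        intro j
        have h1 : (q j : ℝ) < R := by exact_mod_cast ha.2 j
        have h2 : (q' j : ℝ) < R := by exact_mod_cast hb.2 j
        have h3 : (0 : ℝ) ≤ q j := Nat.cast_nonneg _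
        have h4 : (0 : ℝ) ≤ q' j := Nat.cast_nonneg _
        rw [abs_le]
        constructor <;> linarith
      -- Points built from different levels cannot be close: that would bring the grid point of
      -- level `s'` down to level `2 s + 2 ≤ 2 s'`.
      have key : ∀ {s s' : ℕ} {q q' : Fin d → ℕ}, s < s' → s' < M →
          (∀ j, |(q j : ℝ) - q' j| ≤ R) →
          (∃ p : ℤ, |x (s, q) - x (s', q') - p| < c * ε) → False := by
        rintro s s' q q' hss hs' hd ⟨p, hp⟩
        apply hi2 s' hs'
        refine hTmono (show 2 * s + 1 + 1 ≤ 2 * s' by omega) ?_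
        refine hTstep (fun j => (q j : ℤ) - q' j) p (fun j => ?_) ?_ (hi1 s (by omega))
        · push_cast
          exact hd j
        · have : c * ε ≤ ε := by nlinarith
          refine le_trans (le_of_eq ?_) (hp.le.trans this)
          rw [← abs_neg]
          congr 1
          simp only [hx]
          push_cast
          simp only [mul_sub, Finset.sum_sub_distrib]
          ring
      rcases lt_trichotomy s s' with hss | hss | hss
      · exact (key hss hb.1 hdiff ⟨_, hclose⟩).elim
      · subst hss
        by_contra hne
        have hqq : (fun j => (q j : ℤ) - q' j) ≠ 0 := by
          intro h0
          apply hne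
          congr 1
          funext j
          have := congrFun h0 j
          simp only [Pi.zero_apply] at this
          omega
        -- On a single level, separation is the bad approximability of the form on differences of
        -- size at most `R`.
        have h5 := h _ hqq (⌊x (s, q)⌋ - ⌊x (s, q')⌋ : ℤ)
        have h6 : ∏ j, max 1 |(((q j : ℤ) - q' j : ℤ) : ℝ)| ≤ (R : ℝ) ^ d := by
          calc ∏ j, max 1 |(((q j : ℤ) - q' j : ℤ) : ℝ)| ≤ ∏ _j : Fin d, (R : ℝ) :=
                Finset.prod_le_prod (fun j _ => le_max_of_le_left zero_le_one) fun j _ => by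
                  push_cast
                  exact max_le hR1 (hdiff j)
            _ = (R : ℝ) ^ d := by simp
        have h7 : |∑ j, α j * (((q j : ℤ) - q' j : ℤ) : ℝ) - (⌊x (s, q)⌋ - ⌊x (s, q')⌋ : ℤ)|
            < c * ε := by
          refine lt_of_eq_of_lt ?_ hclose
          congr 2
          simp only [hx]
          push_cast
          simp only [mul_sub, Finset.sum_sub_distrib]
          ring
        have h8 := h5.trans_lt (lt_of_le_of_lt (mul_le_mul_of_nonneg_left h6 (abs_nonneg _))
          (mul_lt_mul_of_pos_right h7 (by positivity)))
        rw [hε] at h8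
        have : c * (1 / (R : ℝ) ^ d) * (R : ℝ) ^ d = c := by field_simp
        linarith
      · refine (key (q := q') (q' := q) hss ha.1 (fun j => ?_)
          ⟨-(⌊x (s, q)⌋ - ⌊x (s', q')⌋ : ℤ), ?_⟩).elim
        · rw [abs_sub_comm]
          exact hdiff j
        · rw [← abs_neg]
          refine lt_of_eq_of_lt ?_ hclose
          congr 1
          push_cast
          ring
  rw [hS, Finset.card_product, Finset.card_range, Fintype.card_piFinset, Finset.card_range] at hcard
  simp only [Finset.card_range, Finset.prod_const, Finset.card_univ, Fintype.card_fin] at hcard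
  have h1 : (M : ℝ) * (R : ℝ) ^ d ≤ 1 / (c * ε) + 1 := by
    have := Nat.floor_le (one_div_pos.2 hcε).le
    have h2 : (M : ℝ) * (R : ℝ) ^ d ≤ (⌊1 / (c * ε)⌋₊ : ℝ) + 1 := by exact_mod_cast hcard
    linarith
  have h2 : 1 / (c * ε) = (R : ℝ) ^ d / c := by
    rw [hε]
    field_simp
  have h3 : (R : ℝ) ^ d / c + 1 ≤ 2 / c * (R : ℝ) ^ d := by
    have : 1 ≤ (R : ℝ) ^ d / c := by
      rw [le_div_iff₀ hc]
      linarith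
    have e : 2 / c * (R : ℝ) ^ d = (R : ℝ) ^ d / c + (R : ℝ) ^ d / c := by ring
    linarith
  have h4 : 2 / c * (R : ℝ) ^ d < M * (R : ℝ) ^ d := mul_lt_mul_of_pos_right hM (by positivity)
  rw [h2] at h1
  linarith

/-! ### Positive lower limits and uniform lower bounds. -/

theorem littlewoodLiminf_pos_of_le {m : ℕ} {α : Fin m → ℝ} {c : ℝ} (hc : 0 < c)
    (h : ∀ n : ℕ, 1 ≤ n → c ≤ n * ∏ j, distInt (n * α j)) : 0 < littlewoodLiminf α := by
  refine lt_of_lt_of_le (EReal.coe_pos.2 hc) ?_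
  refine Filter.le_liminf_of_le (by isBoundedDefault) ?_
  filter_upwards [Filter.eventually_ge_atTop 1] with n hn
  exact EReal.coe_le_coe_iff.2 (h n hn)

/-- Replacing `n` by a fixed multiple `N' n` passes the threshold of the lower limit and changes the
product by at most the factor `N' ^ (m + 1)`. No finite set of exceptional `n` survives. -/
theorem exists_le_of_littlewoodLiminf_pos {m : ℕ} {α : Fin m → ℝ} (h : 0 < littlewoodLiminf α) :
    ∃ c : ℝ, 0 < c ∧ ∀ n : ℕ, 1 ≤ n → c ≤ n * ∏ j, distInt (n * α j) := by
  obtain ⟨c, hc0, hc⟩ := EReal.lt_iff_exists_real_btwn.1 h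
  have hc0' : 0 < c := EReal.coe_pos.1 hc0
  have hev := Filter.eventually_lt_of_lt_liminf hc (by isBoundedDefault)
  obtain ⟨N, hN⟩ := Filter.eventually_atTop.1 hev
  set N' := N + 1 with hN'
  have hN'0 : (0 : ℝ) < N' := by positivity
  refine ⟨c / (N' : ℝ) ^ (m + 1), by positivity, fun n hn => ?_⟩
  rw [div_le_iff₀ (by positivity)]
  have h1 := EReal.coe_lt_coe_iff.1 (hN (N' * n) (by nlinarith))
  refine h1.le.trans ?_
  push_cast
  have h2 : ∏ j, distInt ((N' : ℝ) * n * α j) ≤ ∏ j, ((N' : ℝ) * distInt (n * α j)) :=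
    Finset.prod_le_prod (fun j _ => distInt_nonneg _) fun j _ => by
      rw [mul_assoc]
      exact distInt_nat_mul_le N' _
  refine (mul_le_mul_of_nonneg_left h2 (by positivity)).trans (le_of_eq ?_)
  rw [Finset.prod_mul_distrib, Finset.prod_const, Finset.card_univ, Fintype.card_fin]
  ring

theorem LittlewoodConjecture.not_two_le (hL : LittlewoodConjecture) {α β c : ℝ} (hc : 0 < c)
    (h : ∀ n : ℕ, 1 ≤ n → c ≤ n * (distInt (n * α) * distInt (n * β))) : False := by
  have := littlewoodLiminf_pos_of_le (α := ![α, β]) hc (by simpa [Fin.prod_univ_two] using h)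
  rw [hL α β] at this
  exact lt_irrefl _ this

/-- All factors beyond the first two are at most one and can be dropped. -/
theorem LittlewoodConjecture.littlewoodLiminf_nonpos (hL : LittlewoodConjecture) {m : ℕ}
    (hm : 2 ≤ m) (α : Fin m → ℝ) : ¬ 0 < littlewoodLiminf α := by
  intro hpos
  obtain ⟨c, hc, h⟩ := exists_le_of_littlewoodLiminf_pos hpos
  obtain ⟨m, rfl⟩ : ∃ l, m = l + 2 := ⟨m - 2, by omega⟩
  refine hL.not_two_le hc (α := α 0) (β := α 1) fun n hn => (h n hn).trans ?_
  rw [Fin.prod_univ_succ, Fin.prod_univ_succ, ← mul_assoc (distInt _)]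
  refine mul_le_mul_of_nonneg_left ?_ (Nat.cast_nonneg n)
  refine mul_le_of_le_one_right (mul_nonneg (distInt_nonneg _) (distInt_nonneg _)) ?_
  exact Finset.prod_le_one (fun j _ => distInt_nonneg _) fun j _ =>
    (distInt_le_half _).trans (by norm_num)

/-! ### Coordinates, the strip and equivalence of patches. -/

noncomputable section

namespace CutProject

theorem d_le_k {k d : ℕ} (D : CutProject k d) : d ≤ k := by
  have h := Submodule.finrank_le D.E
  rw [D.finrank_E] at h
  simpa using h

variable {k d : ℕ} (D : CutProject k d)

/-- The first `d` coordinates of a point of `ℝᵏ`. -/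
def head (z : RSpace k) : RSpace d := WithLp.toLp 2 fun j => z (Fin.castLE D.d_le_k j)

/-- The point of `ℝᵏ` with first coordinates `x` and last coordinates taken from `y`. -/
def glue (x : Fin d → ℝ) (y : Fin k → ℝ) : RSpace k :=
  WithLp.toLp 2 fun i => if h : i.val < d then x ⟨i.val, h⟩ else y i

/-- The coefficients of the linear map whose graph is `E`. -/
def coef (i : Fin k) (j : Fin d) : ℝ :=
  -(D.ρstar (embedCoord k d (EuclideanSpace.single j 1))) i

/-- The linear forms defining `E`. -/
def form (i : Fin k) (x : Fin d → ℝ) : ℝ := ∑ j, D.coef i j * x j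

@[simp]
theorem head_apply (z : RSpace k) (j : Fin d) : D.head z j = z (Fin.castLE D.d_le_k j) := rfl

theorem head_add (z w : RSpace k) : D.head (z + w) = D.head z + D.head w := rfl

@[simp]
theorem head_glue (x : Fin d → ℝ) (y : Fin k → ℝ) (j : Fin d) : D.head (glue x y) j = x j := by
  simp [glue]

@[simp]
theorem glue_apply_of_le (x : Fin d → ℝ) (y : Fin k → ℝ) {i : Fin k} (hi : d ≤ i) :
    (glue x y) i = y i := by
  simp [glue, not_lt.2 hi]

theorem glue_mem_intLattice (x : Fin d → ℤ) (y : Fin k → ℤ) :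
    glue (fun j => (x j : ℝ)) (fun i => (y i : ℝ)) ∈ intLattice k := by
  intro i
  by_cases hi : i.val < d
  · exact ⟨x ⟨i, hi⟩, by simp [glue, hi]⟩
  · exact ⟨y i, by simp [glue, hi]⟩

@[simp]
theorem head_embedCoord (x : RSpace d) : D.head (embedCoord k d x) = x := by
  ext j
  simp [embedCoord]

theorem form_add (i : Fin k) (x y : Fin d → ℝ) :
    D.form i (fun j => x j + y j) = D.form i x + D.form i y := by
  simp [form, mul_add, Finset.sum_add_distrib]

theorem form_sub (i : Fin k) (x y : Fin d → ℝ) :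
    D.form i (fun j => x j - y j) = D.form i x - D.form i y := by
  simp [form, mul_sub, Finset.sum_sub_distrib]

theorem head_eq_zero_of_mem {z : RSpace k} (hz : z ∈ refSubspace k d) : D.head z = 0 := by
  ext j
  exact hz _ j.2

theorem ρstar_mem (z : RSpace k) : D.ρstar z ∈ refSubspace k d :=
  Submodule.projection_apply_mem _ _

theorem ρ_mem (z : RSpace k) : D.ρ z ∈ D.E := Submodule.projection_apply_mem _ _

theorem π_mem (z : RSpace k) : D.π z ∈ D.E := Submodule.projection_apply_mem _ _

theorem ρ_add_ρstar (z : RSpace k) : D.ρ z + D.ρstar z = z :=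
  Submodule.projection_add_projection_eq_self D.compl_rho z

theorem ρstar_eq_zero_iff {z : RSpace k} : D.ρstar z = 0 ↔ z ∈ D.E :=
  Submodule.projection_apply_eq_zero_iff _

theorem ρ_eq_zero_iff {z : RSpace k} : D.ρ z = 0 ↔ z ∈ refSubspace k d :=
  Submodule.projection_apply_eq_zero_iff _

theorem ρstar_of_mem {z : RSpace k} (hz : z ∈ refSubspace k d) : D.ρstar z = z :=
  Submodule.projection_apply_of_mem_left _ hz

theorem ρ_of_mem {z : RSpace k} (hz : z ∈ D.E) : D.ρ z = z :=
  Submodule.projection_apply_of_mem_left _ hz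

theorem π_of_mem {z : RSpace k} (hz : z ∈ D.E) : D.π z = z :=
  Submodule.projection_apply_of_mem_left _ hz

theorem head_ρ (z : RSpace k) : D.head (D.ρ z) = D.head z := by
  conv_rhs => rw [← D.ρ_add_ρstar z, head_add, D.head_eq_zero_of_mem (D.ρstar_mem z), add_zero]

theorem sub_embedCoord_head_mem (z : RSpace k) :
    z - embedCoord k d (D.head z) ∈ refSubspace k d := by
  intro i hi
  simp [embedCoord, hi]

theorem ρ_embedCoord_head (z : RSpace k) : D.ρ (embedCoord k d (D.head z)) = D.ρ z := by
  have := D.ρ_eq_zero_iff.2 (D.sub_embedCoord_head_mem z)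
  rw [map_sub, sub_eq_zero] at this
  exact this.symm

theorem embedCoord_eq_sum (x : RSpace d) :
    embedCoord k d x = ∑ j, x j • embedCoord k d (EuclideanSpace.single j 1) := by
  ext i
  simp only [embedCoord, WithLp.ofLp_sum, WithLp.ofLp_smul, Finset.sum_apply, Pi.smul_apply,
    smul_eq_mul]
  by_cases hi : i.val < d
  · simp only [hi, dif_pos]
    rw [Finset.sum_eq_single ⟨i.val, hi⟩]
    · simp
    · intro j _ hj
      simp [hj.symm]
    · simp
  · simp [hi]

/-- The coordinates of `ρ*` in terms of the linear forms. -/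
theorem ρstar_apply (z : RSpace k) {i : Fin k} (hi : d ≤ i) :
    D.ρstar z i = z i - D.form i (D.head z) := by
  have h1 : z = (z - embedCoord k d (D.head z)) + embedCoord k d (D.head z) := by abel
  have h2 : D.ρstar z = (z - embedCoord k d (D.head z)) +
      ∑ j, D.head z j • D.ρstar (embedCoord k d (EuclideanSpace.single j 1)) := by
    conv_lhs => rw [h1, map_add, D.ρstar_of_mem (D.sub_embedCoord_head_mem z), embedCoord_eq_sum,
      map_sum]
    simp only [map_smul]
    rw [← embedCoord_eq_sum]
  rw [h2]
  have h3 : embedCoord k d (D.head z) i = 0 := by simp [embedCoord, not_lt.2 hi]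
  simp only [PiLp.add_apply, PiLp.sub_apply, h3, WithLp.ofLp_sum, WithLp.ofLp_smul,
    Finset.sum_apply, Pi.smul_apply, smul_eq_mul, form, coef]
  rw [sub_zero, sub_eq_add_neg, ← Finset.sum_neg_distrib]
  congr 1
  exact Finset.sum_congr rfl fun j _ => by ring

theorem ρstar_eq_iff {z w : RSpace k} :
    D.ρstar z = D.ρstar w ↔ ∀ i : Fin k, d ≤ i → D.ρstar z i = D.ρstar w i := by
  refine ⟨fun h i _ => by rw [h], fun h => ?_⟩
  ext i
  rcases le_or_gt d i with hi | hi
  · exact h i hi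
  · rw [D.ρstar_mem z i hi, D.ρstar_mem w i hi]

theorem ρ_mem_toE {B : Set (RSpace d)} {z : RSpace k} : D.ρ z ∈ D.toE B ↔ D.head z ∈ B := by
  constructor
  · rintro ⟨_, ⟨b, hb, rfl⟩, h⟩
    have := congrArg D.head h
    rw [D.head_ρ, D.head_ρ, head_embedCoord] at this
    rwa [← this]
  · intro h
    exact ⟨_, ⟨_, h, rfl⟩, D.ρ_embedCoord_head z⟩

theorem mem_toE_of_mem {B : Set (RSpace d)} {y : RSpace k} (hy : y ∈ D.E) :
    y ∈ D.toE B ↔ D.head y ∈ B := by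
  rw [← D.ρ_mem_toE, D.ρ_of_mem hy]

theorem add_mem_strip_iff {z x : RSpace k} (hx : x ∈ D.E) : z + x ∈ D.strip ↔ z ∈ D.strip := by
  constructor
  · rintro ⟨w, hw, e, he, h⟩
    refine ⟨w, hw, e - x, D.E.sub_mem he hx, ?_⟩
    simp only at h ⊢
    rw [← add_sub_assoc, h, add_sub_cancel_right]
  · rintro ⟨w, hw, e, he, rfl⟩
    exact ⟨w, hw, e + x, D.E.add_mem he hx, (add_assoc _ _ _).symm⟩

theorem mem_strip_iff (h : D.window = D.ρstar '' unitCube k) {z : RSpace k} :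
    z ∈ D.strip ↔ ∃ t ∈ unitCube k, D.ρstar t = D.ρstar z := by
  rw [← Set.mem_image, ← h]
  have : z ∈ D.strip ↔ D.ρstar z ∈ D.strip := by
    conv_lhs => rw [← D.ρ_add_ρstar z, add_comm, D.add_mem_strip_iff (D.ρ_mem z)]
  rw [this]
  exact ⟨fun h => ⟨h, D.ρstar_mem z⟩, fun h => h.1⟩

/-- A point of the cube with prescribed `ρ*` is determined by its first `d` coordinates; `x` stands
for these. -/
theorem mem_strip_iff_form (h : D.window = D.ρstar '' unitCube k) {z : RSpace k} :
    z ∈ D.strip ↔ ∃ x : Fin d → ℝ, (∀ j, 0 ≤ x j ∧ x j ≤ 1) ∧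
      ∀ i : Fin k, d ≤ i → 0 ≤ D.ρstar z i + D.form i x ∧ D.ρstar z i + D.form i x ≤ 1 := by
  rw [D.mem_strip_iff h]
  constructor
  · rintro ⟨t, ht, hz⟩
    refine ⟨D.head t, fun j => ht _, fun i hi => ?_⟩
    rw [← hz, D.ρstar_apply t hi, sub_add_cancel]
    exact ht i
  · rintro ⟨x, hx, hz⟩
    refine ⟨glue x fun i => D.ρstar z i + D.form i x, fun i => ?_, ?_⟩
    · by_cases hi : i.val < d
      · simpa [glue, hi] using hx ⟨i, hi⟩
      · simpa [glue, hi] using hz i (not_lt.1 hi)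
    · rw [D.ρstar_eq_iff]
      intro i hi
      rw [D.ρstar_apply _ hi, glue_apply_of_le _ _ hi]
      have : (D.head (glue x fun i => D.ρstar z i + D.form i x) : Fin d → ℝ) = x :=
        funext fun j => D.head_glue _ _ j
      rw [this, add_sub_cancel_right]

theorem π_add_s_injOn {n n' : RSpace k} (hn : n ∈ intLattice k) (hn' : n' ∈ intLattice k)
    (h : D.π (n + D.s) = D.π (n' + D.s)) : n = n' := by
  rw [map_add, map_add, add_left_inj] at h
  exact D.injOn_pi hn hn' h

theorem π_mem_Y_iff {n : RSpace k} (hn : n ∈ intLattice k) :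
    D.π (n + D.s) ∈ D.Y ↔ n + D.s ∈ D.strip := by
  constructor
  · rintro ⟨_, ⟨hz, n', hn', rfl⟩, h⟩
    rwa [← D.π_add_s_injOn hn' hn h]
  · intro h
    exact ⟨_, ⟨h, n, hn, rfl⟩, rfl⟩

theorem mem_Y_iff {y : RSpace k} :
    y ∈ D.Y ↔ ∃ n ∈ intLattice k, n + D.s ∈ D.strip ∧ D.π (n + D.s) = y := by
  constructor
  · rintro ⟨_, ⟨hz, n', hn', rfl⟩, h⟩
    exact ⟨n', hn', hz, h⟩
  · rintro ⟨n, hn, h, rfl⟩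
    exact (D.π_mem_Y_iff hn).2 h

theorem mem_patch_iff {Ω : Set (RSpace d)} {n y' : RSpace k} (hn : n ∈ intLattice k) :
    y' ∈ D.patch (D.π (n + D.s)) Ω ↔ ∃ m ∈ intLattice k, D.head m ∈ Ω ∧
      n + m + D.s ∈ D.strip ∧ y' = D.π (n + m + D.s) := by
  constructor
  · rintro ⟨hY, n₁, h₁, n₂, h₂, h3, rfl, h5⟩
    obtain rfl := D.π_add_s_injOn h₁ hn h3
    refine ⟨n₂ - n₁, sub_mem h₂ h₁, D.ρ_mem_toE.1 h5, ?_, ?_⟩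
    · rw [add_sub_cancel]
      exact (D.π_mem_Y_iff h₂).1 hY
    · rw [add_sub_cancel]
  · rintro ⟨m, hm, h1, h2, rfl⟩
    refine ⟨(D.π_mem_Y_iff (add_mem hn hm)).2 h2, n, hn, n + m, add_mem hn hm, rfl, rfl, ?_⟩
    rw [add_sub_cancel_left]
    exact D.ρ_mem_toE.2 h1

/-- Two patches are equivalent when the same lattice vectors lead from their centres to points of
the strip. -/
theorem patchEquiv_iff {Ω : Set (RSpace d)} {n n' : RSpace k} (hn : n ∈ intLattice k)
    (hn' : n' ∈ intLattice k) :
    D.PatchEquiv Ω (D.π (n' + D.s)) (D.π (n + D.s)) ↔ ∀ m ∈ intLattice k, D.head m ∈ Ω →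
      (n' + m + D.s ∈ D.strip ↔ n + m + D.s ∈ D.strip) := by
  have hshift : ∀ m, D.π (n + m + D.s) + (D.π (n' + D.s) - D.π (n + D.s)) =
      D.π (n' + m + D.s) := by
    intro m
    rw [← map_sub, ← map_add]
    congr 1
    abel
  constructor
  · intro h m hm hΩ
    constructor
    · intro hS
      have : D.π (n' + m + D.s) ∈ D.patch (D.π (n' + D.s)) Ω :=
        (D.mem_patch_iff hn').2 ⟨m, hm, hΩ, hS, rfl⟩
      rw [h] at this
      obtain ⟨y, hy, hyy⟩ := this
      obtain ⟨m', hm', -, hS', rfl⟩ := (D.mem_patch_iff hn).1 hy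
      simp only at hyy
      rw [hshift] at hyy
      have := add_left_cancel (D.π_add_s_injOn (add_mem hn' hm') (add_mem hn' hm) hyy)
      rwa [← this]
    · intro hS
      have : D.π (n' + m + D.s) ∈ D.patch (D.π (n' + D.s)) Ω := by
        rw [h]
        exact ⟨_, (D.mem_patch_iff hn).2 ⟨m, hm, hΩ, hS, rfl⟩, hshift m⟩
      obtain ⟨m', hm', -, hS', hyy⟩ := (D.mem_patch_iff hn').1 this
      have := add_left_cancel (D.π_add_s_injOn (add_mem hn' hm) (add_mem hn' hm') hyy)
      rwa [this]
  · intro h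
    ext y
    rw [D.mem_patch_iff hn']
    constructor
    · rintro ⟨m, hm, hΩ, hS, rfl⟩
      exact ⟨_, (D.mem_patch_iff hn).2 ⟨m, hm, hΩ, (h m hm hΩ).1 hS, rfl⟩, hshift m⟩
    · rintro ⟨_, hy, rfl⟩
      obtain ⟨m, hm, hΩ, hS, rfl⟩ := (D.mem_patch_iff hn).1 hy
      exact ⟨m, hm, hΩ, (h m hm hΩ).2 hS, hshift m⟩

/-- On the strip, the projections `π` and `ρ` differ by a bounded amount. -/
theorem exists_head_π_bound (h : D.window = D.ρstar '' unitCube k) :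
    ∃ K : ℝ, 0 ≤ K ∧ ∀ z ∈ D.strip, ∀ j, |D.head (D.π z) j - D.head z j| ≤ K := by
  have hcomp : IsCompact (unitCube k) := by
    have : unitCube k = WithLp.ofLp ⁻¹' (Set.Icc (0 : Fin k → ℝ) 1) := by
      ext x
      simp [unitCube, Pi.le_def, forall_and]
    rw [this]
    exact (PiLp.homeomorph 2 (fun _ : Fin k => ℝ)).isCompact_preimage.2 isCompact_Icc
  -- `π z - ρ z = π (ρ* z)`, and on the strip `ρ* z` lies in the compact image of the cube.
  have hcont : Continuous (D.π ∘ₗ D.ρstar) := LinearMap.continuous_of_finiteDimensional _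
  obtain ⟨K, hK⟩ := hcomp.exists_bound_of_continuousOn hcont.continuousOn
  refine ⟨max K 0, le_max_right _ _, fun z hz j => ?_⟩
  obtain ⟨t, ht, htz⟩ := (D.mem_strip_iff h).1 hz
  have h1 : D.π z = D.ρ z + D.π (D.ρstar t) := by
    conv_lhs => rw [← D.ρ_add_ρstar z, map_add, D.π_of_mem (D.ρ_mem z), ← htz]
  rw [h1, head_add, head_ρ]
  simp only [PiLp.add_apply, add_sub_cancel_left, head_apply]
  exact ((PiLp.norm_apply_le _ _).trans (hK t ht)).trans (le_max_left _ _)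

/-- A pattern occurring in a region, expressed by lattice points. -/
theorem occursIn_iff {Ω : Set (RSpace d)} {n : RSpace k} (hn : n ∈ intLattice k)
    {B : Set (RSpace d)} :
    D.OccursIn Ω (D.π (n + D.s)) B ↔ ∃ n' ∈ intLattice k, n' + D.s ∈ D.strip ∧
      D.head (D.π (n' + D.s)) ∈ B ∧ ∀ m ∈ intLattice k, D.head m ∈ Ω →
      (n' + m + D.s ∈ D.strip ↔ n + m + D.s ∈ D.strip) := by
  constructor
  · rintro ⟨y', hY, hB, hP⟩
    obtain ⟨n', hn', hS, rfl⟩ := D.mem_Y_iff.1 hY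
    exact ⟨n', hn', hS, (D.mem_toE_of_mem (D.π_mem _)).1 hB, (D.patchEquiv_iff hn hn').1 hP⟩
  · rintro ⟨n', hn', hS, hB, h⟩
    exact ⟨_, (D.π_mem_Y_iff hn').2 hS, (D.mem_toE_of_mem (D.π_mem _)).2 hB,
      (D.patchEquiv_iff hn hn').2 h⟩

end CutProject

end

/-! ### Symbolic coding of patches and coverings of the torus. -/

noncomputable section

/-- Translation by `θ` moves `u` across an integer in an unexpected way only if `u` is close to an
integer. -/
theorem exists_int_of_floor_ne {u θ : ℝ} (h : ⌊u + θ⌋ - ⌊u⌋ ≠ round θ) :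
    ∃ j : ℤ, |u + (θ - round θ) / 2 - j| ≤ |θ - round θ| / 2 := by
  set ε := θ - round θ with hε
  have e : ⌊u + θ⌋ = ⌊u + ε⌋ + round θ := by
    rw [← Int.floor_add_intCast]
    congr 1
    rw [hε]
    ring
  have hne : ⌊u + ε⌋ ≠ ⌊u⌋ := fun h' => h (by rw [e, h']; ring)
  rcases le_total 0 ε with h0 | h0
  · have hle : ⌊u⌋ + 1 ≤ ⌊u + ε⌋ :=
      lt_of_le_of_ne (Int.floor_mono (by linarith)) hne.symm
    refine ⟨⌊u + ε⌋, ?_⟩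
    have h1 := Int.floor_le (u + ε)
    have h2 := Int.lt_floor_add_one u
    have h3 : ((⌊u⌋ : ℝ) + 1) ≤ ⌊u + ε⌋ := by exact_mod_cast hle
    rw [abs_of_nonneg h0, abs_le]
    constructor <;> linarith
  · have hle : ⌊u + ε⌋ + 1 ≤ ⌊u⌋ := lt_of_le_of_ne (Int.floor_mono (by linarith)) hne
    refine ⟨⌊u⌋, ?_⟩
    have h1 := Int.floor_le u
    have h2 := Int.lt_floor_add_one (u + ε)
    have h3 : ((⌊u + ε⌋ : ℝ) + 1) ≤ ⌊u⌋ := by exact_mod_cast hle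
    rw [abs_of_nonpos h0, abs_le]
    constructor <;> linarith

/-- Partial converse of `exists_int_of_floor_ne`. The inequality is strict so that it defines an
open set, which a dense orbit meets. -/
theorem floor_ne_of_abs_lt {u θ : ℝ} {j : ℤ}
    (h : |u + (θ - round θ) / 2 - j| < |θ - round θ| / 2) : ⌊u + θ⌋ - ⌊u⌋ ≠ round θ := by
  set ε := θ - round θ with hε
  have e : ⌊u + θ⌋ = ⌊u + ε⌋ + round θ := by
    rw [← Int.floor_add_intCast]
    congr 1
    rw [hε]
    ring
  intro h'
  have heq : ⌊u + ε⌋ = ⌊u⌋ := by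
    rw [e] at h'
    linarith
  rw [abs_lt] at h
  rcases le_total 0 ε with h0 | h0
  · rw [abs_of_nonneg h0] at h
    have h1 : j ≤ ⌊u + ε⌋ := Int.le_floor.2 (by linarith)
    have h2 : ⌊u⌋ < j := Int.floor_lt.2 (by linarith)
    omega
  · rw [abs_of_nonpos h0] at h
    have h1 : j ≤ ⌊u⌋ := Int.le_floor.2 (by linarith)
    have h2 : ⌊u + ε⌋ < j := Int.floor_lt.2 (by linarith)
    omega

theorem norm_unitAddCircle_le (x : ℝ) (p : ℤ) : ‖(x : UnitAddCircle)‖ ≤ |x - p| := by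
  rw [UnitAddCircle.norm_eq]
  exact round_le x p

theorem unitAddCircle_coe_int (p : ℤ) : ((p : ℝ) : UnitAddCircle) = 0 := by
  rw [AddCircle.coe_eq_zero_iff]
  exact ⟨p, by simp⟩

/-- If finitely many translates of a box cover a dense subset of the torus then the total volume
of these translates is at least one. -/
theorem one_le_card_mul_of_dense {ι : Type} [Fintype ι] (S : Set (ι → UnitAddCircle))
    (hS : Dense S) (V : Finset (ι → UnitAddCircle)) (c : ι → UnitAddCircle) (r : ι → ℝ)
    (hr : ∀ i, 0 ≤ r i)
    (h : ∀ x ∈ S, ∃ v ∈ V, ∀ i, x i ∈ Metric.closedBall (c i - v i) (r i / 2)) :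
    1 ≤ (V.card : ℝ) * ∏ i, r i := by
  set T : (ι → UnitAddCircle) → Set (ι → UnitAddCircle) :=
    fun v => Set.pi Set.univ fun i => Metric.closedBall (c i - v i) (r i / 2) with hT
  have hclosed : IsClosed (⋃ v ∈ V, T v) := by
    refine V.finite_toSet.isClosed_biUnion fun v _ => ?_
    exact isClosed_set_pi fun i _ => Metric.isClosed_closedBall
  -- A finite union of closed boxes is closed, so containing a dense set forces it to be everything.
  have huniv : (⋃ v ∈ V, T v) = Set.univ := by
    rw [Set.eq_univ_iff_forall]
    intro x
    rw [← hclosed.closure_eq]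
    refine closure_mono ?_ (hS x)
    intro y hy
    obtain ⟨v, hv, hvy⟩ := h y hy
    exact Set.mem_biUnion hv fun i _ => hvy i
  have hvol : ∀ v, MeasureTheory.volume (T v) ≤ ENNReal.ofReal (∏ i, r i) := by
    intro v
    rw [hT, MeasureTheory.volume_pi_pi, ENNReal.ofReal_prod_of_nonneg fun i _ => hr i]
    refine Finset.prod_le_prod' fun i _ => ?_
    rw [AddCircle.volume_closedBall]
    refine ENNReal.ofReal_le_ofReal ((min_le_right _ _).trans (le_of_eq ?_))
    ring
  have h1 : (1 : ENNReal) ≤ ∑ _v ∈ V, ENNReal.ofReal (∏ i, r i) := by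
    calc (1 : ENNReal) = MeasureTheory.volume (Set.univ : Set (ι → UnitAddCircle)) := by
          rw [← Set.pi_univ, MeasureTheory.volume_pi_pi]
          simp
      _ = MeasureTheory.volume (⋃ v ∈ V, T v) := by rw [huniv]
      _ ≤ ∑ v ∈ V, MeasureTheory.volume (T v) := MeasureTheory.measure_biUnion_finset_le _ _
      _ ≤ _ := Finset.sum_le_sum fun v _ => hvol v
  rw [Finset.sum_const, nsmul_eq_mul, ← ENNReal.ofReal_natCast,
    ← ENNReal.ofReal_mul (Nat.cast_nonneg _), ENNReal.one_le_ofReal] at h1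
  exact h1

namespace CutProject

variable {k d : ℕ} (D : CutProject k d)

/-- The largest value of the `i`-th coordinate on the window. -/
def top (i : Fin k) : ℝ := 1 + ∑ j, max 0 (-D.coef i j)

/-- The values of some of the linear forms at an integer point, as a point of the torus. -/
def torusPoint {ι : Type} (e : ι → Fin k) (q : Fin d → ℤ) (i : ι) : UnitAddCircle :=
  ((D.form (e i) fun j => (q j : ℝ) : ℝ) : UnitAddCircle)

theorem ρstar_le_top (h : D.window = D.ρstar '' unitCube k) {z : RSpace k} (hz : z ∈ D.strip)
    {i : Fin k} (hi : d ≤ i) : D.ρstar z i ≤ D.top i := by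
  obtain ⟨x, hx, hz'⟩ := (D.mem_strip_iff_form h).1 hz
  have h1 : -D.form i x ≤ ∑ j, max 0 (-D.coef i j) := by
    rw [form, ← Finset.sum_neg_distrib]
    refine Finset.sum_le_sum fun j _ => ?_
    have h3 := le_max_left 0 (-D.coef i j)
    have h4 := le_max_right 0 (-D.coef i j)
    nlinarith [hx j]
  have := (hz' i hi).2
  rw [top]
  linarith

theorem ρstar_add_apply (z m : RSpace k) {q : Fin d → ℤ} (hq : ∀ j, D.head m j = q j)
    {i : Fin k} (hi : d ≤ i) :
    D.ρstar (z + m) i = D.ρstar z i + m i - D.form i fun j => (q j : ℝ) := by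
  rw [map_add, PiLp.add_apply, D.ρstar_apply m hi, funext hq]
  ring

/-- The bound of `ρstar_le_top` is attained up to integrality. `x` is the vertex of the `d`-cube
minimising `L_i`, so the window reaches its top in coordinate `i`. The other coordinates of `m` are
rounded so that the same `x` witnesses membership. -/
theorem exists_lattice_mem_strip (h : D.window = D.ρstar '' unitCube k) (z : RSpace k)
    (q : Fin d → ℤ) {i : Fin k} (hi : d ≤ i) : ∃ m ∈ intLattice k, (∀ j, D.head m j = q j) ∧
      m i = ⌊D.top i - D.ρstar z i + D.form i fun j => (q j : ℝ)⌋ ∧ z + m ∈ D.strip := by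
  set x : Fin d → ℝ := fun j => if D.coef i j < 0 then 1 else 0 with hx
  set f : Fin k → ℤ := fun l => ⌊1 - D.form l x - D.ρstar z l + D.form l fun j => (q j : ℝ)⌋ with hf
  have hq : ∀ j, D.head (glue (fun j => (q j : ℝ)) fun l => (f l : ℝ)) j = q j := fun j =>
    D.head_glue _ _ j
  refine ⟨_, glue_mem_intLattice q f, hq, ?_, ?_⟩
  · rw [glue_apply_of_le _ _ hi]
    simp only [hf]
    congr 4
    rw [top, form, sub_eq_add_neg, ← Finset.sum_neg_distrib]
    congr 1
    refine Finset.sum_congr rfl fun j _ => ?_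
    simp only [hx]
    split_ifs with hj
    · rw [mul_one, max_eq_right (by linarith)]
    · rw [mul_zero, neg_zero, max_eq_left (by linarith)]
  · rw [D.mem_strip_iff_form h]
    refine ⟨x, fun j => ?_, fun l hl => ?_⟩
    · simp only [hx]
      split_ifs <;> norm_num
    · rw [D.ρstar_add_apply z _ hq hl, glue_apply_of_le _ _ hl]
      have h1 := Int.floor_le (1 - D.form l x - D.ρstar z l + D.form l fun j => (q j : ℝ))
      have h2 := Int.lt_floor_add_one (1 - D.form l x - D.ρstar z l + D.form l fun j => (q j : ℝ))
      simp only [hf]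
      constructor <;> linarith

/-- Equivalent patches have the same symbolic coding by the linear forms. -/
theorem floor_eq_of_equiv (h : D.window = D.ρstar '' unitCube k) {Ω : Set (RSpace d)}
    {n n' : RSpace k}
    (hΩ : ∀ m ∈ intLattice k, D.head m ∈ Ω → (n' + m + D.s ∈ D.strip ↔ n + m + D.s ∈ D.strip))
    {q : Fin d → ℤ} (hq : WithLp.toLp 2 (fun j => (q j : ℝ)) ∈ Ω) {i : Fin k} (hi : d ≤ i) :
    ⌊D.top i - D.ρstar (n' + D.s) i + D.form i fun j => (q j : ℝ)⌋ =
      ⌊D.top i - D.ρstar (n + D.s) i + D.form i fun j => (q j : ℝ)⌋ := by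
  -- The floor is the largest `i`-th coordinate of a lattice vector over `q` leading into the strip,
  -- a quantity that the patch determines.
  have key : ∀ n n' : RSpace k,
      (∀ m ∈ intLattice k, D.head m ∈ Ω → (n + m + D.s ∈ D.strip → n' + m + D.s ∈ D.strip)) →
      ⌊D.top i - D.ρstar (n + D.s) i + D.form i fun j => (q j : ℝ)⌋ ≤
      ⌊D.top i - D.ρstar (n' + D.s) i + D.form i fun j => (q j : ℝ)⌋ := by
    intro n n' hnn
    obtain ⟨m, hm, hmq, hmi, hS⟩ := D.exists_lattice_mem_strip h (n + D.s) q hi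
    have hmΩ : D.head m ∈ Ω := by
      have : D.head m = WithLp.toLp 2 (fun j => (q j : ℝ)) := by
        ext j
        exact hmq j
      rwa [this]
    have h1 := hnn m hm hmΩ (by rwa [add_right_comm])
    rw [add_right_comm] at h1
    have h2 := D.ρstar_le_top h h1 hi
    rw [D.ρstar_add_apply _ _ hmq hi, hmi] at h2
    rw [Int.le_floor]
    linarith
  exact le_antisymm (key n' n fun m hm hmΩ => (hΩ m hm hmΩ).1)
    (key n n' fun m hm hmΩ => (hΩ m hm hmΩ).2)

theorem torusPoint_add {ι : Type} (e : ι → Fin k) (q q' : Fin d → ℤ) (i : ι) :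
    D.torusPoint e (q + q') i = D.torusPoint e q i + D.torusPoint e q' i := by
  simp only [torusPoint, Pi.add_apply, Int.cast_add, form_add, AddCircle.coe_add]

theorem abs_form_le (i : Fin k) {x : Fin d → ℝ} {δ : ℝ} (hx : ∀ j, |x j| ≤ δ) :
    |D.form i x| ≤ (∑ j, |D.coef i j|) * δ := by
  rw [form, Finset.sum_mul]
  refine (Finset.abs_sum_le_sum_abs _ _).trans (Finset.sum_le_sum fun j _ => ?_)
  rw [abs_mul]
  exact mul_le_mul_of_nonneg_left (hx j) (abs_nonneg _)

/-- If the image of `E` is dense in the torus, then so are the values of the linear forms at the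
integer points, modulo one. -/
theorem denseRange_torusPoint (h : D.IsTotallyIrrational) {ι : Type} [Fintype ι] (e : ι → Fin k)
    (he : Function.Injective e) (hde : ∀ i, d ≤ e i) :
    DenseRange (D.torusPoint e) := by
  rw [Metric.denseRange_iff]
  intro t δ hδ
  have hex : ∀ i, ∃ r : ℝ, (r : UnitAddCircle) = t i := fun i =>
    QuotientAddGroup.mk_surjective (t i)
  choose t' ht' using hex
  set C := ∑ l, ∑ j, |D.coef l j| with hC
  have hC0 : 0 ≤ C := Finset.sum_nonneg fun _ _ => Finset.sum_nonneg fun _ _ => abs_nonneg _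
  set δ' := δ / (2 * (1 + C)) with hδ'
  have hδ'0 : 0 < δ' := by positivity
  -- Aim at a point with vanishing head and last coordinates lifting `t`. A point of `E` near it
  -- modulo a lattice vector `n` makes `-head n` the desired integer point.
  set z : RSpace k := glue (0 : Fin d → ℝ) (Function.extend e t' 0) with hz
  have hopen : IsOpen ((QuotientAddGroup.mk : RSpace k → RSpace k ⧸ intLattice k) ''
      Metric.ball z δ') := QuotientAddGroup.isOpenMap_coe _ Metric.isOpen_ball
  obtain ⟨_, ⟨w, hw, hwx⟩, ⟨x, hx, rfl⟩⟩ := h.inter_open_nonempty _ hopen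
    ⟨_, z, Metric.mem_ball_self hδ'0, rfl⟩
  rw [eq_comm, QuotientAddGroup.eq] at hwx
  choose n hn using hwx
  refine ⟨fun j => -n (Fin.castLE D.d_le_k j), ?_⟩
  rw [dist_pi_lt_iff hδ]
  intro i
  have hcoord : ∀ l, |w l - z l| < δ' := fun l =>
    lt_of_le_of_lt (PiLp.norm_apply_le (w - z) l) (by simpa [dist_eq_norm] using hw)
  have hhead : ∀ j, |D.head w j| ≤ δ' := by
    intro j
    have := hcoord (Fin.castLE D.d_le_k j)
    have hz0 : z (Fin.castLE D.d_le_k j) = 0 := by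
      have := D.head_glue (0 : Fin d → ℝ) (Function.extend e t' 0) j
      simpa [hz] using this
    rw [hz0, sub_zero] at this
    exact this.le
  have hxE : D.form (e i) (D.head x) = x (e i) := by
    have h0 := D.ρstar_eq_zero_iff.2 hx
    have h1 := D.ρstar_apply x (hde i)
    rw [h0] at h1
    simp only [PiLp.zero_apply] at h1
    linarith
  have hzi : z (e i) = t' i := by
    rw [hz, glue_apply_of_le _ _ (hde i), he.extend_apply]
  rw [dist_comm, dist_eq_norm, ← ht' i, torusPoint, ← AddCircle.coe_sub]
  refine (norm_unitAddCircle_le _ (-n (e i))).trans_lt ?_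
  have e1 : (fun j => (((-n (Fin.castLE D.d_le_k j) : ℤ)) : ℝ)) =
      fun j => D.head x j - D.head w j := by
    funext j
    have := hn (Fin.castLE D.d_le_k j)
    simp only [PiLp.add_apply, PiLp.neg_apply] at this
    push_cast
    rw [← this]
    simp only [head_apply]
    ring
  have e2 := hn (e i)
  simp only [PiLp.add_apply, PiLp.neg_apply] at e2
  rw [e1, form_sub, hxE]
  push_cast
  rw [← e2]
  have h4 := hcoord (e i)
  rw [hzi] at h4
  have h5 : |D.form (e i) (D.head w)| ≤ C * δ' := by
    refine (D.abs_form_le (e i) hhead).trans (mul_le_mul_of_nonneg_right ?_ hδ'0.le)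
    exact Finset.single_le_sum (f := fun l => ∑ j, |D.coef l j|)
      (fun l _ => Finset.sum_nonneg fun _ _ => abs_nonneg _) (Finset.mem_univ (e i))
  have e3 : x.ofLp (e i) - D.form (e i) (D.head w).ofLp - t' i - -(-x.ofLp (e i) + w.ofLp (e i)) =
      (w (e i) - t' i) - D.form (e i) (D.head w) := by ring
  rw [e3]
  refine (abs_sub _ _).trans_lt ?_
  have e4 : δ' + C * δ' = δ / 2 := by
    rw [hδ']
    field_simp
  linarith

/-- The central counting estimate: if every pattern of shape `Ω` occurs in every translate of `B`
then the torus is covered by as many boxes as there are values of the linear forms near `B`. -/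
theorem exists_covering_bound (hD : D.IsCanonical) : ∃ K : ℝ, 0 ≤ K ∧
    ∀ (Ω B : Set (RSpace d)),
    (∀ q₀ : Fin d → ℤ, ∀ y ∈ D.Y, ∃ B' : Set (RSpace d), D.OccursIn Ω y B' ∧
      ∀ b ∈ B', b - WithLp.toLp 2 (fun j => (q₀ j : ℝ)) ∈ B) →
    (0 : RSpace d) ∈ Ω →
    ∀ (ι : Type) [Fintype ι] (e : ι → Fin k), Function.Injective e → (∀ i, d ≤ e i) →
    ∀ m : ι → Fin d → ℤ, (∀ i, WithLp.toLp 2 (fun j => (m i j : ℝ)) ∈ Ω) →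
    (∀ i, distInt (D.form (e i) fun j => (m i j : ℝ)) ≠ 0) →
    ∀ V : Finset (ι → UnitAddCircle),
    (∀ q : Fin d → ℤ, (∃ b ∈ B, ∀ j, |(q j : ℝ) - b j| ≤ K) → D.torusPoint e q ∈ V) →
    1 ≤ (V.card : ℝ) * ∏ i, distInt (D.form (e i) fun j => (m i j : ℝ)) := by
  obtain ⟨-, hTI, -, hW⟩ := hD
  obtain ⟨K, hK0, hK⟩ := D.exists_head_π_bound hW
  -- `K` compares `π` with `ρ`; the sum accounts for the shift by `s`.
  refine ⟨K + ∑ j, |D.head D.s j|, add_nonneg hK0 (Finset.sum_nonneg fun _ _ => abs_nonneg _), ?_⟩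
  intro Ω B hocc h0 ι _ e he hde m hm hθ V hV
  set θ : ι → ℝ := fun i => D.form (e i) fun j => (m i j : ℝ) with hθdef
  set ε : ι → ℝ := fun i => θ i - round (θ i) with hε
  set a : ι → ℝ := fun i => D.top (e i) - D.ρstar D.s (e i) with ha
  have hdense := D.denseRange_torusPoint hTI e he hde
  -- The rare pattern: by density its centre can be chosen so that moving by `m i` crosses an
  -- unexpected number of integers in every coordinate `e i` simultaneously.
  obtain ⟨q₁, hq₁⟩ : ∃ q₁ : Fin d → ℤ, D.torusPoint e q₁ ∈ Set.pi Set.univ fun i =>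
      Metric.ball ((-(ε i / 2) - a i : ℝ) : UnitAddCircle) (|ε i| / 2) := by
    refine hdense.exists_mem_open (isOpen_set_pi Set.finite_univ fun i _ => Metric.isOpen_ball) ?_
    refine ⟨fun i => ((-(ε i / 2) - a i : ℝ) : UnitAddCircle), fun i _ =>
      Metric.mem_ball_self ?_⟩
    have : 0 < |ε i| := lt_of_le_of_ne (abs_nonneg _) (Ne.symm (hθ i))
    positivity
  -- With this choice `ρ*(n + s)` has its coordinates of index at least `d` in `[0, 1)`, so the
  -- corner `x = 0` of the cube witnesses membership in the strip.
  set g : Fin k → ℤ := fun l => -⌊D.ρstar D.s l - D.form l fun j => (q₁ j : ℝ)⌋ with hg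
  set n : RSpace k := glue (fun j => (q₁ j : ℝ)) fun l => (g l : ℝ) with hn
  have hnL : n ∈ intLattice k := glue_mem_intLattice q₁ g
  have hnq : ∀ j, D.head n j = q₁ j := fun j => D.head_glue _ _ j
  have hnS : n + D.s ∈ D.strip := by
    rw [D.mem_strip_iff_form hW]
    refine ⟨0, by simp, fun l hl => ?_⟩
    rw [add_comm n, D.ρstar_add_apply _ _ hnq hl, hn, glue_apply_of_le _ _ hl]
    have h1 := Int.floor_le (D.ρstar D.s l - D.form l fun j => (q₁ j : ℝ))
    have h2 := Int.lt_floor_add_one (D.ρstar D.s l - D.form l fun j => (q₁ j : ℝ))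
    have h3 : D.form l 0 = 0 := by simp [form]
    simp only [hg, h3]
    push_cast
    constructor <;> linarith
  set u : RSpace k → ι → ℝ := fun n i => D.top (e i) - D.ρstar (n + D.s) (e i) with hu
  have hun : ∀ i, ⌊u n i + θ i⌋ - ⌊u n i⌋ ≠ round (θ i) := by
    intro i
    have h1 := hq₁ i (Set.mem_univ i)
    rw [Metric.mem_ball, dist_eq_norm, torusPoint, ← AddCircle.coe_sub, UnitAddCircle.norm_eq] at h1
    set x := (D.form (e i) fun j => (q₁ j : ℝ)) - (-(ε i / 2) - a i) with hx
    refine floor_ne_of_abs_lt (j := round x - g (e i)) (lt_of_eq_of_lt ?_ h1)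
    congr 1
    simp only [hu]
    rw [add_comm n, D.ρstar_add_apply _ _ hnq (hde i), hn, glue_apply_of_le _ _ (hde i), hx]
    push_cast
    simp only [ha, hε]
    ring
  refine one_le_card_mul_of_dense _ hdense V (fun i => ((-(ε i / 2) - a i : ℝ) : UnitAddCircle))
    (fun i => distInt (θ i)) (fun i => distInt_nonneg _) ?_
  rintro _ ⟨q₀, rfl⟩
  obtain ⟨B', hB', hBB⟩ := hocc q₀ _ ((D.π_mem_Y_iff hnL).2 hnS)
  obtain ⟨n', hn'L, hn'S, hpos, hequiv⟩ := (D.occursIn_iff hnL).1 hB'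
  have hint : ∀ l, ∃ p : ℤ, n' l = p := hn'L
  choose p hp using hint
  set q : Fin d → ℤ := fun j => p (Fin.castLE D.d_le_k j) - q₀ j with hq
  refine ⟨D.torusPoint e q, hV q ⟨_, hBB _ hpos, fun j => ?_⟩, fun i => ?_⟩
  · have h1 := hK _ hn'S j
    have h2 : |D.head D.s j| ≤ ∑ j, |D.head D.s j| :=
      Finset.single_le_sum (f := fun j => |D.head D.s j|) (fun _ _ => abs_nonneg _)
        (Finset.mem_univ j)
    have e1 : ((q j : ℤ) : ℝ) - (D.head (D.π (n' + D.s)) - WithLp.toLp 2 fun j => (q₀ j : ℝ)) j =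
        -(D.head (D.π (n' + D.s)) j - D.head (n' + D.s) j) - D.head D.s j := by
      simp only [hq, PiLp.sub_apply, head_add, PiLp.add_apply, head_apply, hp]
      push_cast
      ring
    rw [e1]
    refine (abs_sub _ _).trans ?_
    rw [abs_neg]
    exact add_le_add h1 h2
  · have h00 : WithLp.toLp 2 (fun j => (((0 : Fin d → ℤ) j : ℤ) : ℝ)) ∈ Ω := by
      have : WithLp.toLp 2 (fun j => (((0 : Fin d → ℤ) j : ℤ) : ℝ)) = (0 : RSpace d) := by
        ext j
        simp
      rwa [this]
    -- Comparing the codes at `0` and at `m i` carries the unexpected crossing from `n` to `n'`;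
    -- this is why `0 ∈ Ω` is needed.
    have f0 := D.floor_eq_of_equiv hW hequiv h00 (hde i)
    have f1 := D.floor_eq_of_equiv hW hequiv (hm i) (hde i)
    have hform0 : D.form (e i) (fun j => (((0 : Fin d → ℤ) j : ℤ) : ℝ)) = 0 := by simp [form]
    rw [hform0, add_zero, add_zero] at f0
    have hne : ⌊u n' i + θ i⌋ - ⌊u n' i⌋ ≠ round (θ i) := by
      have := hun i
      simp only [hu, hθdef] at this ⊢
      rwa [f0, f1]
    obtain ⟨j, hj⟩ := exists_int_of_floor_ne hne
    rw [Metric.mem_closedBall, dist_eq_norm]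
    have hn'q : ∀ j, D.head n' j = ((q₀ + q) j : ℤ) := by
      intro j
      simp [hq, hp]
    -- Since `head n' = q₀ + q`, closeness of `u n' i + ε i / 2` to an integer puts the arbitrary
    -- orbit point of `q₀` into the box translated by that of `q`.
    have e2 : D.torusPoint e q₀ i - (((-(ε i / 2) - a i : ℝ) : UnitAddCircle) -
        D.torusPoint e q i) = ((u n' i + ε i / 2 : ℝ) : UnitAddCircle) := by
      have : D.torusPoint e q₀ i - (((-(ε i / 2) - a i : ℝ) : UnitAddCircle) -
          D.torusPoint e q i) = D.torusPoint e (q₀ + q) i -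
          ((-(ε i / 2) - a i : ℝ) : UnitAddCircle) := by
        rw [torusPoint_add]
        abel
      rw [this, torusPoint, ← AddCircle.coe_sub]
      simp only [hu]
      rw [add_comm n', D.ρstar_add_apply _ _ hn'q (hde i), hp]
      have e3 : D.top (e i) - (D.ρstar D.s (e i) + (p (e i) : ℝ) -
          D.form (e i) fun j => ((q₀ + q) j : ℝ)) + ε i / 2 =
          ((D.form (e i) fun j => (((q₀ + q) j : ℤ) : ℝ)) - (-(ε i / 2) - a i)) - (p (e i) : ℝ) := by
        simp only [ha]
        ring
      rw [e3, AddCircle.coe_sub _ _ (p (e i) : ℝ), unitAddCircle_coe_int, sub_zero]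
    rw [e2]
    exact (norm_unitAddCircle_le _ j).trans hj

end CutProject

end

/-! ### Diophantine consequences of repetitivity. -/

noncomputable section

theorem volume_alignedBox {d : ℕ} {a b : Fin d → ℤ} (hab : ∀ i, a i < b i) :
    MeasureTheory.volume {x : RSpace d | ∀ i, (a i : ℝ) ≤ x i ∧ x i ≤ (b i : ℝ)} =
      ENNReal.ofReal (∏ i, ((b i : ℝ) - a i)) := by
  have h1 : {x : RSpace d | ∀ i, (a i : ℝ) ≤ x i ∧ x i ≤ (b i : ℝ)} =
      WithLp.ofLp ⁻¹' (Set.Icc (fun i => (a i : ℝ)) fun i => (b i : ℝ)) := by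
    ext x
    simp [Pi.le_def, forall_and]
  rw [h1, (PiLp.volume_preserving_ofLp (Fin d)).measure_preimage
    measurableSet_Icc.nullMeasurableSet, Real.volume_Icc_pi, ENNReal.ofReal_prod_of_nonneg]
  intro i _
  have : (a i : ℝ) < b i := by exact_mod_cast hab i
  linarith

theorem exists_volume_ball_eq {d : ℕ} (hd : 1 ≤ d) : ∃ v : ℝ, 0 < v ∧ ∀ (x : RSpace d) (r : ℝ),
    0 ≤ r → MeasureTheory.volume (Metric.ball x r) = ENNReal.ofReal (v * r ^ d) := by
  have : Nonempty (Fin d) := ⟨⟨0, hd⟩⟩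
  refine ⟨√Real.pi ^ d / Real.Gamma (d / 2 + 1), ?_, fun x r hr => ?_⟩
  · have := Real.Gamma_pos_of_pos (show (0 : ℝ) < d / 2 + 1 by positivity)
    have := Real.sqrt_pos.2 Real.pi_pos
    positivity
  · rw [EuclideanSpace.volume_ball, Fintype.card_fin, mul_comm (_ / _),
      ENNReal.ofReal_mul (by positivity), ENNReal.ofReal_pow hr]

theorem one_le_prod_sub {d : ℕ} {a b : Fin d → ℤ} (hab : ∀ i, a i < b i) :
    1 ≤ ∏ i, ((b i : ℝ) - a i) := by
  rw [← Finset.prod_const_one (s := (Finset.univ : Finset (Fin d)))]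
  refine Finset.prod_le_prod (fun _ _ => zero_le_one) fun i _ => ?_
  have : (a i : ℝ) + 1 ≤ b i := by exact_mod_cast hab i
  linarith

namespace CutProject

variable {k d : ℕ} (D : CutProject k d)

/-- The lower bound for products of values of the linear forms at points of a box which linear
repetitivity entails. -/
def BoxBound (κ : ℝ) : Prop :=
  ∀ a b : Fin d → ℤ, (∀ j, a j < b j) → (∀ j, a j ≤ 0 ∧ 0 ≤ b j) →
    ∀ (ι : Type) [Fintype ι] (e : ι → Fin k), Function.Injective e → (∀ i, d ≤ e i) →
    ∀ m : ι → Fin d → ℤ, (∀ i j, a j ≤ m i j ∧ m i j ≤ b j) →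
    (∀ i, distInt (D.form (e i) fun j => (m i j : ℝ)) ≠ 0) →
    1 ≤ κ * (∏ j, ((b j : ℝ) - a j)) * ∏ i, distInt (D.form (e i) fun j => (m i j : ℝ))

/-- A repetitive set satisfies a covering bound in terms of the points in a ball. -/
theorem IsLR.exists_ball_bound (hd : 1 ≤ d) {D : CutProject k d} (hD : D.IsCanonical)
    (hLR : D.IsLR (alignedBoxes d)) : ∃ A : ℝ, 1 ≤ A ∧
    ∀ a b : Fin d → ℤ, (∀ j, a j < b j) → (∀ j, a j ≤ 0 ∧ 0 ≤ b j) →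
    ∀ R : ℝ, 1 ≤ R → R ^ d = ∏ j, ((b j : ℝ) - a j) →
    ∀ (ι : Type) [Fintype ι] (e : ι → Fin k), Function.Injective e → (∀ i, d ≤ e i) →
    ∀ m : ι → Fin d → ℤ, (∀ i j, a j ≤ m i j ∧ m i j ≤ b j) →
    (∀ i, distInt (D.form (e i) fun j => (m i j : ℝ)) ≠ 0) →
    ∀ V : Finset (ι → UnitAddCircle),
    (∀ q : Fin d → ℤ, (∀ j, |(q j : ℝ)| ≤ A * R) → D.torusPoint e q ∈ V) →
    1 ≤ (V.card : ℝ) * ∏ i, distInt (D.form (e i) fun j => (m i j : ℝ)) := by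
  obtain ⟨C, hC, hLR⟩ := hLR
  obtain ⟨K, hK, hcov⟩ := D.exists_covering_bound hD
  obtain ⟨v, hv, hball⟩ := exists_volume_ball_eq hd
  -- The ball of radius `c₁ R` has volume `C |Ω|`.
  set c₁ := (C / v) ^ (1 / (d : ℝ)) with hc₁
  have hc₁0 : 0 ≤ c₁ := by positivity
  have hc₁d : c₁ ^ d = C / v := by
    rw [hc₁, ← Real.rpow_natCast, ← Real.rpow_mul (by positivity), one_div,
      inv_mul_cancel₀ (by positivity), Real.rpow_one]
  refine ⟨c₁ + K + 1, by linarith, ?_⟩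
  intro a b hab h0 R hR hRP ι _ e he hde m hm hθ V hV
  refine hcov {x | ∀ i, (a i : ℝ) ≤ x i ∧ x i ≤ (b i : ℝ)} (Metric.ball 0 (c₁ * R)) ?_ ?_ ι e he
    hde m ?_ hθ V ?_
  · intro q₀ y hy
    refine ⟨_, hLR _ ⟨a, b, hab, h0, rfl⟩ y hy (WithLp.toLp 2 fun j => (q₀ j : ℝ)) (c₁ * R) ?_, ?_⟩
    · rw [hball _ _ (by positivity), volume_alignedBox hab, ← ENNReal.ofReal_mul hC.le, mul_pow,
        hc₁d, hRP]
      congr 1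
      field_simp
    · intro x hx
      rw [mem_ball_iff_norm] at hx
      rwa [mem_ball_zero_iff]
  · intro j
    have := h0 j
    simp only [PiLp.zero_apply]
    exact_mod_cast this
  · intro i j
    simp only
    exact_mod_cast hm i j
  · rintro q ⟨x, hx, hq⟩
    refine hV q fun j => ?_
    have h1 : |x j| ≤ c₁ * R :=
      (PiLp.norm_apply_le x j).trans (mem_ball_zero_iff.1 hx).le
    have h2 : |(q j : ℝ)| ≤ |(q j : ℝ) - x j| + |x j| := by
      simpa using abs_add_le ((q j : ℝ) - x j) (x j)
    nlinarith [hq j]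

/-- The crude count: at most `(3 A R)^d` integer points lie in the cube of half-side `A R`, and `R^d
= |Ω|`. -/
theorem IsLR.exists_boxBound (hd : 1 ≤ d) {D : CutProject k d} (hD : D.IsCanonical)
    (hLR : D.IsLR (alignedBoxes d)) : ∃ κ : ℝ, 0 < κ ∧ D.BoxBound κ := by
  classical
  obtain ⟨A, hA, h⟩ := hLR.exists_ball_bound hd hD
  refine ⟨(3 * A) ^ d, by positivity, ?_⟩
  intro a b hab h0 ι _ e he hde m hm hθ
  set P := ∏ j, ((b j : ℝ) - a j) with hP
  have hP1 : 1 ≤ P := one_le_prod_sub hab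
  set R := P ^ (1 / (d : ℝ)) with hR
  have hRd : R ^ d = P := by
    rw [hR, ← Real.rpow_natCast, ← Real.rpow_mul (by positivity), one_div,
      inv_mul_cancel₀ (by positivity), Real.rpow_one]
  have hR1 : 1 ≤ R := Real.one_le_rpow hP1 (by positivity)
  set M : ℤ := ⌊A * R⌋ with hM
  have hM0 : 0 ≤ M := Int.floor_nonneg.2 (by positivity)
  set V := (Fintype.piFinset fun _ : Fin d => Finset.Icc (-M) M).image (D.torusPoint e) with hV
  have h1 := h a b hab h0 R hR1 hRd ι e he hde m hm hθ V (by
    intro q hq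
    refine Finset.mem_image_of_mem _ (Fintype.mem_piFinset.2 fun j => ?_)
    rw [Finset.mem_Icc, ← abs_le, hM, Int.le_floor]
    push_cast
    exact hq j)
  refine h1.trans (mul_le_mul_of_nonneg_right ?_ (Finset.prod_nonneg fun i _ => distInt_nonneg _))
  have h2 : (V.card : ℝ) ≤ (2 * M + 1) ^ d := by
    have : V.card ≤ (2 * M + 1).toNat ^ d := by
      refine Finset.card_image_le.trans (le_of_eq ?_)
      rw [Fintype.card_piFinset]
      simp only [Int.card_Icc, Finset.prod_const, Finset.card_univ, Fintype.card_fin]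
      congr 2
      ring
    have h3 : ((2 * M + 1).toNat : ℤ) = 2 * M + 1 := Int.toNat_of_nonneg (by omega)
    have h4 : ((2 * M + 1).toNat : ℝ) = 2 * M + 1 := by exact_mod_cast congrArg (Int.cast (R := ℝ)) h3
    rw [← h4]
    exact_mod_cast this
  refine h2.trans ?_
  rw [← hRd, ← mul_pow]
  refine pow_le_pow_left₀ ?_ ?_ d
  · have : (0 : ℝ) ≤ M := by exact_mod_cast hM0
    linarith
  · have := Int.floor_le (A * R)
    rw [← hM] at this
    nlinarith

/-- Here the points to count lie in `C Ω` thickened by `K`. Since each side of `Ω` is at least one,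
each side contributes at most `C + 2 K + 1` times its length. -/
theorem IsLROmega.exists_boxBound {D : CutProject k d} (hD : D.IsCanonical)
    (hLR : D.IsLROmega (alignedBoxes d)) : ∃ κ : ℝ, 0 < κ ∧ D.BoxBound κ := by
  classical
  obtain ⟨C, hC, hLR⟩ := hLR
  obtain ⟨K, hK, hcov⟩ := D.exists_covering_bound hD
  refine ⟨(C + 2 * K + 1) ^ d, by positivity, ?_⟩
  intro a b hab h0 ι _ e he hde m hm hθ
  set V := (Fintype.piFinset fun j : Fin d => Finset.Icc ⌈C * a j - K⌉ ⌊C * b j + K⌋).image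
    (D.torusPoint e) with hV
  have h1 := hcov {x | ∀ i, (a i : ℝ) ≤ x i ∧ x i ≤ (b i : ℝ)}
    {x | ∀ i, C * a i ≤ x i ∧ x i ≤ C * b i} (by
      intro q₀ y hy
      refine ⟨_, hLR _ ⟨a, b, hab, h0, rfl⟩ y hy (WithLp.toLp 2 fun j => (q₀ j : ℝ)), ?_⟩
      rintro _ ⟨x, hx, rfl⟩ j
      simp only [add_sub_cancel_left, PiLp.smul_apply, smul_eq_mul]
      exact ⟨mul_le_mul_of_nonneg_left (hx j).1 hC.le, mul_le_mul_of_nonneg_left (hx j).2 hC.le⟩)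
    (by
      intro j
      have := h0 j
      simp only [PiLp.zero_apply]
      exact_mod_cast this) ι e he hde m
    (by
      intro i j
      simp only
      exact_mod_cast hm i j) hθ V (by
      rintro q ⟨x, hx, hq⟩
      refine Finset.mem_image_of_mem _ (Fintype.mem_piFinset.2 fun j => ?_)
      rw [Finset.mem_Icc, Int.ceil_le, Int.le_floor]
      have h2 := abs_le.1 (hq j)
      have h3 := hx j
      constructor <;> linarith)
  refine h1.trans (mul_le_mul_of_nonneg_right ?_ (Finset.prod_nonneg fun i _ => distInt_nonneg _))
  have h2 : (V.card : ℝ) ≤ ∏ j, (((⌊C * b j + K⌋ + 1 - ⌈C * a j - K⌉).toNat : ℕ) : ℝ) := by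
    have : V.card ≤ ∏ j, (⌊C * b j + K⌋ + 1 - ⌈C * a j - K⌉).toNat := by
      refine Finset.card_image_le.trans (le_of_eq ?_)
      rw [Fintype.card_piFinset]
      simp only [Int.card_Icc]
    exact_mod_cast this
  refine h2.trans ?_
  have h3 : (C + 2 * K + 1) ^ d * ∏ j, ((b j : ℝ) - a j) =
      ∏ j, ((C + 2 * K + 1) * ((b j : ℝ) - a j)) := by
    rw [Finset.prod_mul_distrib, Finset.prod_const, Finset.card_univ, Fintype.card_fin]
  rw [h3]
  refine Finset.prod_le_prod (fun j _ => Nat.cast_nonneg _) fun j _ => ?_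
  have hab1 : (a j : ℝ) + 1 ≤ b j := by exact_mod_cast hab j
  rcases le_total 0 (⌊C * b j + K⌋ + 1 - ⌈C * a j - K⌉) with h4 | h4
  · have h5 : (((⌊C * b j + K⌋ + 1 - ⌈C * a j - K⌉).toNat : ℕ) : ℝ) =
        ⌊C * b j + K⌋ + 1 - ⌈C * a j - K⌉ := by
      exact_mod_cast congrArg (Int.cast (R := ℝ)) (Int.toNat_of_nonneg h4)
    rw [h5]
    have h6 := Int.floor_le (C * b j + K)
    have h7 := Int.le_ceil (C * a j - K)
    nlinarith
  · rw [Int.toNat_of_nonpos h4, Nat.cast_zero]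
    have : (0 : ℝ) ≤ b j - a j := by linarith
    positivity

theorem form_single (i : Fin k) (j : Fin d) (t : ℤ) :
    D.form i (fun l => ((Pi.single j t : Fin d → ℤ) l : ℝ)) = t * D.coef i j := by
  rw [form, Finset.sum_eq_single j]
  · simp [mul_comm]
  · intro l _ hl
    simp [hl]
  · simp

variable {D}

/-- In each direction the box is the integer interval joining `0` and `m j`, or a unit interval when
`m j = 0`. Its sides are `max 1 |m j|`, which turns `BoxBound` into bad approximability of the form.
-/
theorem BoxBound.one_le_distInt_form {κ : ℝ} (h : D.BoxBound κ) {i : Fin k} (hi : d ≤ i)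
    {m : Fin d → ℤ} (hm : distInt (D.form i fun j => (m j : ℝ)) ≠ 0) :
    1 ≤ κ * (∏ j, max 1 |(m j : ℝ)|) * distInt (D.form i fun j => (m j : ℝ)) := by
  have h1 := h (fun j => min 0 (m j)) (fun j => if m j < 0 then 0 else max 1 (m j))
    (by
      intro j
      split_ifs with hj
      · exact min_lt_of_right_lt hj
      · exact (min_le_left _ _).trans_lt (lt_max_of_lt_left one_pos))
    (by
      intro j
      refine ⟨min_le_left _ _, ?_⟩
      split_ifs
      · exact le_rfl
      · exact le_max_of_le_left zero_le_one)
    Unit (fun _ => i) (fun _ _ _ => rfl) (fun _ => hi) (fun _ => m)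
    (by
      intro _ j
      refine ⟨min_le_right _ _, ?_⟩
      split_ifs with hj
      · exact hj.le
      · exact le_max_right _ _)
    (fun _ => hm)
  have h2 : ∀ j, (((if m j < 0 then 0 else max 1 (m j) : ℤ) : ℝ) - ((min 0 (m j) : ℤ) : ℝ)) =
      max 1 |(m j : ℝ)| := by
    intro j
    have h3 : (if m j < 0 then 0 else max 1 (m j)) - min 0 (m j) = max 1 |m j| := by
      split_ifs with hj
      · rw [min_eq_right hj.le, abs_of_neg hj, max_eq_right (by omega)]
        ring
      · rw [min_eq_left (by omega), abs_of_nonneg (by omega), sub_zero]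
    rw [← Int.cast_sub, h3]
    push_cast
    rfl
  simp only [h2, Finset.univ_unique, Finset.prod_singleton] at h1
  exact h1

theorem distInt_ne_zero_of_irrational {x : ℝ} (hx : Irrational x) : distInt x ≠ 0 := by
  intro h
  obtain ⟨p, hp⟩ := distInt_eq_zero_iff.1 h
  exact hx.ne_int p hp

/-- Two of the linear forms cannot depend irrationally on the same variable. -/
theorem BoxBound.eq_of_irrational {κ : ℝ} (hκ : 0 < κ) (h : D.BoxBound κ) {i₁ i₂ : Fin k}
    (h₁ : d ≤ i₁) (h₂ : d ≤ i₂) {j : Fin d} (hi₁ : Irrational (D.coef i₁ j))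
    (hi₂ : Irrational (D.coef i₂ j)) : i₁ = i₂ := by
  by_contra hne
  obtain ⟨N, hN⟩ := exists_nat_gt κ
  have hN0 : (0 : ℝ) < N := hκ.trans hN
  have hN0' : 0 < N := by exact_mod_cast hN0
  obtain ⟨t₁, ht₁, ht₁N, hd₁⟩ := Real.exists_nat_abs_mul_sub_round_le (D.coef i₁ j) hN0'
  obtain ⟨t₂, ht₂, ht₂N, hd₂⟩ := Real.exists_nat_abs_mul_sub_round_le (D.coef i₂ j) hN0'
  have hf₁ : D.form i₁ (fun l => ((Pi.single j (t₁ : ℤ) : Fin d → ℤ) l : ℝ)) =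
      t₁ * D.coef i₁ j := by rw [form_single]; simp
  have hf₂ : D.form i₂ (fun l => ((Pi.single j (t₂ : ℤ) : Fin d → ℤ) l : ℝ)) =
      t₂ * D.coef i₂ j := by rw [form_single]; simp
  -- The box has side `N` in direction `j` and one elsewhere. Dirichlet makes both factors at most
  -- `1 / (N + 1)`, against a volume of only `N`.
  have h1 := h 0 (Function.update 1 j (N : ℤ))
    (by
      intro l
      by_cases hl : l = j
      · subst hl
        simpa using hN0'
      · simp [hl])
    (by
      intro l
      by_cases hl : l = j
      · subst hl
        simp
      · simp [hl])
    (Fin 2) ![i₁, i₂]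
    (by
      intro x y hxy
      fin_cases x <;> fin_cases y <;> simp_all)
    (by
      intro x
      fin_cases x <;> simp_all)
    ![Pi.single j (t₁ : ℤ), Pi.single j (t₂ : ℤ)]
    (by
      intro x l
      by_cases hl : l = j
      · subst hl
        fin_cases x <;> simp [ht₁N, ht₂N]
      · fin_cases x <;> simp [hl])
    (by
      intro x
      fin_cases x
      · simp only [Fin.zero_eta, Matrix.cons_val_zero]
        rw [hf₁]
        exact distInt_ne_zero_of_irrational (hi₁.natCast_mul ht₁.ne')
      · simp only [Fin.mk_one, Matrix.cons_val_one, Matrix.cons_val_zero]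
        rw [hf₂]
        exact distInt_ne_zero_of_irrational (hi₂.natCast_mul ht₂.ne'))
  rw [Fin.prod_univ_two] at h1
  simp only [Matrix.cons_val_zero, Matrix.cons_val_one] at h1
  rw [hf₁, hf₂] at h1
  have hprod : ∏ l, (((Function.update (1 : Fin d → ℤ) j (N : ℤ) l : ℤ) : ℝ) -
      (((0 : Fin d → ℤ) l : ℤ) : ℝ)) = N := by
    rw [Finset.prod_eq_single j]
    · simp
    · intro l _ hl
      simp [hl]
    · simp
  rw [hprod] at h1
  have h2 : distInt (t₁ * D.coef i₁ j) * distInt (t₂ * D.coef i₂ j) ≤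
      1 / ((N : ℝ) + 1) * (1 / ((N : ℝ) + 1)) :=
    mul_le_mul hd₁ hd₂ (distInt_nonneg _) (by positivity)
  have h3 := h1.trans (mul_le_mul_of_nonneg_left h2 (by positivity))
  have h4 : κ * N * (1 / ((N : ℝ) + 1) * (1 / ((N : ℝ) + 1))) < 1 := by
    rw [one_div_mul_one_div, mul_one_div, div_lt_one (by positivity)]
    nlinarith
  linarith

theorem exists_common_denominator {ι : Type*} [Fintype ι] (x : ι → ℝ)
    (hx : ∀ i, ¬ Irrational (x i)) : ∃ b : ℕ, 0 < b ∧ ∀ i, ∃ p : ℤ, (b : ℝ) * x i = p := by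
  classical
  have h : ∀ i, ∃ r : ℚ, (r : ℝ) = x i := fun i => not_not.1 (hx i)
  choose r hr using h
  refine ⟨∏ i, (r i).den, Finset.prod_pos fun i _ => (r i).den_pos, fun i => ?_⟩
  refine ⟨(∏ l ∈ Finset.univ.erase i, (r l).den : ℕ) * (r i).num, ?_⟩
  rw [← Finset.mul_prod_erase Finset.univ _ (Finset.mem_univ i), ← hr i]
  have : ((r i).den : ℝ) * (r i : ℝ) = (r i).num := by
    exact_mod_cast Rat.den_mul_eq_num (r i)
  push_cast
  rw [← this]
  ring

/-- Each of the linear forms has an irrational coefficient. -/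
theorem IsTotallyIrrational.exists_irrational (h : D.IsTotallyIrrational) {i : Fin k}
    (hi : d ≤ i) : ∃ j, Irrational (D.coef i j) := by
  by_contra hcon
  push Not at hcon
  obtain ⟨b, hb, hint⟩ := exists_common_denominator (D.coef i) hcon
  choose p hp using hint
  have hb0 : (0 : ℝ) < b := by exact_mod_cast hb
  have hdense := D.denseRange_torusPoint h (fun _ : Unit => i) (fun _ _ _ => rfl) fun _ => hi
  rw [Metric.denseRange_iff] at hdense
  -- With common denominator `b` all values lie in `b⁻¹ ℤ`, and `1 / (2 b)` is at distance `1 / (2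
  -- b)` from that set.
  obtain ⟨q, hq⟩ := hdense (fun _ => ((1 / (2 * b) : ℝ) : UnitAddCircle)) (1 / (4 * b))
    (by positivity)
  rw [dist_pi_lt_iff (by positivity)] at hq
  have h1 := hq ()
  rw [dist_eq_norm, torusPoint, ← AddCircle.coe_sub, UnitAddCircle.norm_eq] at h1
  set x := 1 / (2 * (b : ℝ)) - D.form i fun j => (q j : ℝ) with hx
  have h2 : (b : ℝ) * x = 1 / 2 - (∑ j, p j * q j : ℤ) := by
    rw [hx, mul_sub, form, Finset.mul_sum]
    congr 1
    · field_simp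
    · push_cast
      exact Finset.sum_congr rfl fun j _ => by rw [← mul_assoc, hp]
  have h3 : |(1 / 2 : ℝ) - ((∑ j, p j * q j) + b * round x : ℤ)| < 1 / 4 := by
    have e : (1 / 2 : ℝ) - ((∑ j, p j * q j) + b * round x : ℤ) = b * (x - round x) := by
      push_cast at h2 ⊢
      rw [mul_sub, h2]
      ring
    rw [e, abs_mul, abs_of_pos hb0]
    have := mul_lt_mul_of_pos_left h1 hb0
    refine this.trans_eq ?_
    field_simp
  rw [abs_lt] at h3
  generalize (∑ j, p j * q j) + b * round x = w at h3
  have h4 : (0 : ℝ) < w := by linarith [h3.2]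
  have h5 : (w : ℝ) < 1 := by linarith [h3.1]
  have h6 : (0 : ℤ) < w := by exact_mod_cast h4
  have h7 : w < (1 : ℤ) := by exact_mod_cast h5
  omega

/-- An aperiodic set has no lattice vectors in its physical space. -/
theorem IsAperiodic.eq_zero_of_mem (h : D.IsAperiodic) {x : RSpace k} (hx : x ∈ intLattice k)
    (hxE : x ∈ D.E) : x = 0 := by
  refine h x hxE ?_
  have hshift : ∀ x ∈ intLattice k, x ∈ D.E → ∀ y ∈ D.Y, y + x ∈ D.Y := by
    intro x hx hxE y hy
    obtain ⟨n, hn, hS, rfl⟩ := D.mem_Y_iff.1 hy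
    refine D.mem_Y_iff.2 ⟨n + x, add_mem hn hx, ?_, ?_⟩
    · rw [add_right_comm]
      exact (D.add_mem_strip_iff hxE).2 hS
    · rw [add_right_comm, map_add, D.π_of_mem hxE]
  ext y
  constructor
  · rintro ⟨y, hy, rfl⟩
    exact hshift x hx hxE y hy
  · intro hy
    refine ⟨y + -x, hshift _ (neg_mem hx) (D.E.neg_mem hxE) y hy, ?_⟩
    simp

/-- In an aperiodic set, every nonzero integer vector has an irrational value under one of the
linear forms. -/
theorem IsAperiodic.exists_irrational_form (h : D.IsAperiodic) {m : Fin d → ℤ} (hm : m ≠ 0) :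
    ∃ i : Fin k, d ≤ i ∧ Irrational (D.form i fun j => (m j : ℝ)) := by
  by_contra hcon
  push Not at hcon
  obtain ⟨b, hb, hint⟩ := exists_common_denominator
    (fun i : Fin k => if d ≤ i then D.form i fun j => (m j : ℝ) else 0) (by
      intro i
      split_ifs with hi
      · exact hcon i hi
      · exact not_irrational_zero)
  choose p hp using hint
  -- If all forms were rational at `m`, clearing denominators would give a lattice vector in `E`
  -- with head `b m`.
  set x : RSpace k := glue (fun j => ((b * m j : ℤ) : ℝ)) fun i => (p i : ℝ) with hx
  have hx0 : x = 0 := by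
    refine h.eq_zero_of_mem (glue_mem_intLattice _ p) ?_
    rw [← D.ρstar_eq_zero_iff, ← map_zero D.ρstar, D.ρstar_eq_iff]
    intro i hi
    rw [map_zero, D.ρstar_apply _ hi, glue_apply_of_le _ _ hi, PiLp.zero_apply, ← hp i, if_pos hi,
      funext (D.head_glue _ _), form, form, Finset.mul_sum, ← Finset.sum_sub_distrib]
    refine Finset.sum_eq_zero fun j _ => ?_
    push_cast
    ring
  apply hm
  funext j
  have h1 := D.head_glue (fun j => ((b * m j : ℤ) : ℝ)) (fun i => (p i : ℝ)) j
  rw [← hx, hx0] at h1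
  simp only [head_apply, PiLp.zero_apply] at h1
  have h2 : (b : ℤ) * m j = 0 := by exact_mod_cast h1.symm
  rcases mul_eq_zero.1 h2 with h3 | h3
  · omega
  · simpa using h3

end CutProject

end

/-! ### Obstructions to repetitivity. -/

noncomputable section

namespace CutProject

variable {k d : ℕ} {D : CutProject k d}

/-- A form with a rational coefficient at `j` is periodic modulo one in that direction, so it takes
far fewer values on a ball than there are integer points. -/
theorem torusPoint_add_single {ι : Type} (e : ι → Fin k) {j : Fin d} {b : ℤ}
    (hb : ∀ i, ∃ p : ℤ, (b : ℝ) * D.coef (e i) j = p) (q : Fin d → ℤ) (z : ℤ) :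
    D.torusPoint e (q + Pi.single j (b * z)) = D.torusPoint e q := by
  funext i
  obtain ⟨p, hp⟩ := hb i
  rw [torusPoint_add]
  have : D.torusPoint e (Pi.single j (b * z)) i = 0 := by
    rw [torusPoint, form_single]
    have e1 : ((b * z : ℤ) : ℝ) * D.coef (e i) j = ((p * z : ℤ) : ℝ) := by
      push_cast
      rw [← hp]
      ring
    rw [e1, unitAddCircle_coe_int]
  rw [this, add_zero]

/-- In codimension at least two no canonical cut and project set is linearly repetitive with
respect to the aligned boxes. -/
theorem IsCanonical.not_isLR_of_lt (hd : 1 ≤ d) (hk : d + 1 < k) (hD : D.IsCanonical) :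
    ¬ D.IsLR (alignedBoxes d) := by
  classical
  intro hLR
  obtain ⟨κ, hκ, hbox⟩ := hLR.exists_boxBound hd hD
  obtain ⟨A, hA, hball⟩ := hLR.exists_ball_bound hd hD
  set i₁ : Fin k := ⟨d, by omega⟩ with hi₁
  set i₂ : Fin k := ⟨d + 1, hk⟩ with hi₂
  have hd₁ : d ≤ i₁ := le_rfl
  have hd₂ : d ≤ i₂ := Nat.le_succ d
  obtain ⟨j₁, hj₁⟩ := hD.2.1.exists_irrational hd₁
  obtain ⟨j₂, hj₂⟩ := hD.2.1.exists_irrational hd₂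
  -- Column `j₂` already has an irrational entry in row `i₂`.
  have hrat : ¬ Irrational (D.coef i₁ j₂) := fun h => by
    have := hbox.eq_of_irrational hκ hd₁ hd₂ h hj₂
    simp [hi₁, hi₂] at this
  obtain ⟨b, hb, hbint⟩ := exists_common_denominator (fun _ : Unit => D.coef i₁ j₂) fun _ => hrat
  have hb0 : (0 : ℤ) < b := by exact_mod_cast hb
  -- Beyond this size `b (3 A R)^(d-1)` values, each giving a box of length at most `1 / (R^d + 1)`,
  -- cannot cover the circle.
  obtain ⟨R, hR⟩ := exists_nat_gt (b * (3 * A) ^ (d - 1))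
  have hR0 : (0 : ℝ) < R := lt_of_le_of_lt (by positivity) hR
  have hR0' : 0 < R := by exact_mod_cast hR0
  have hR1 : (1 : ℝ) ≤ R := by exact_mod_cast hR0'
  obtain ⟨t, ht, htN, hdist⟩ := Real.exists_nat_abs_mul_sub_round_le (D.coef i₁ j₁)
    (pow_pos hR0' d)
  have hf : D.form i₁ (fun l => ((Pi.single j₁ (t : ℤ) : Fin d → ℤ) l : ℝ)) =
      t * D.coef i₁ j₁ := by rw [form_single]; simp
  set M : ℤ := ⌊A * R⌋ with hM
  have hM0 : 0 ≤ M := Int.floor_nonneg.2 (by positivity)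
  -- Along `j₂` only residues modulo `b` are counted.
  set F : Fin d → Finset ℤ := Function.update (fun _ => Finset.Icc (-M) M) j₂ (Finset.Ico 0 (b : ℤ))
    with hF
  set V := (Fintype.piFinset F).image (D.torusPoint fun _ : Unit => i₁) with hV
  -- The thin box has its whole volume `R^d` along `j₁`, so Dirichlet applies with bound `R^d`,
  -- while the search region remains a ball of radius proportional to `R`.
  have h1 := hball 0 (Function.update 1 j₁ ((R : ℤ) ^ d))
    (by
      intro l
      by_cases hl : l = j₁
      · subst hl
        simp only [Pi.zero_apply, Function.update_self]
        exact_mod_cast pow_pos hR0' d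
      · simp [hl])
    (by
      intro l
      by_cases hl : l = j₁
      · subst hl
        simp
      · simp [hl])
    R hR1
    (by
      rw [Finset.prod_eq_single j₁]
      · simp
      · intro l _ hl
        simp [hl]
      · simp)
    Unit (fun _ => i₁) (fun _ _ _ => rfl) (fun _ => hd₁) (fun _ => Pi.single j₁ (t : ℤ))
    (by
      intro _ l
      by_cases hl : l = j₁
      · subst hl
        simp only [Pi.zero_apply, Pi.single_eq_same, Function.update_self]
        exact ⟨by positivity, by exact_mod_cast htN⟩
      · simp [hl])
    (by
      intro _
      rw [hf]
      exact distInt_ne_zero_of_irrational (hj₁.natCast_mul ht.ne'))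
    V
    (by
      intro q hq
      have e1 : q = Function.update q j₂ (q j₂ % b) + Pi.single j₂ ((b : ℤ) * (q j₂ / b)) := by
        funext l
        by_cases hl : l = j₂
        · subst hl
          simp [Int.emod_add_mul_ediv]
        · simp [hl]
      rw [e1, torusPoint_add_single _ (by exact_mod_cast hbint)]
      refine Finset.mem_image_of_mem _ (Fintype.mem_piFinset.2 fun l => ?_)
      by_cases hl : l = j₂
      · subst hl
        simp only [hF, Function.update_self, Finset.mem_Ico]
        exact ⟨Int.emod_nonneg _ hb0.ne', Int.emod_lt_of_pos _ hb0⟩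
      · simp only [hF, ne_eq, hl, not_false_eq_true, Function.update_of_ne]
        rw [Finset.mem_Icc, ← abs_le, hM, Int.le_floor]
        push_cast
        exact hq l)
  simp only [Finset.univ_unique, Finset.prod_singleton] at h1
  rw [hf] at h1
  have hcard : (V.card : ℝ) ≤ b * (3 * A * R) ^ (d - 1) := by
    have h2 : V.card ≤ b * (2 * M + 1).toNat ^ (d - 1) := by
      refine Finset.card_image_le.trans (le_of_eq ?_)
      rw [Fintype.card_piFinset, ← Finset.mul_prod_erase Finset.univ _ (Finset.mem_univ j₂)]
      congr 1
      · simp [hF]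
      · rw [Finset.prod_congr rfl (g := fun _ => (2 * M + 1).toNat)]
        · simp [Finset.card_erase_of_mem]
        · intro l hl
          simp only [hF, Function.update_of_ne (Finset.ne_of_mem_erase hl), Int.card_Icc]
          congr 1
          ring
    have h3 : ((2 * M + 1).toNat : ℝ) = 2 * M + 1 := by
      exact_mod_cast congrArg (Int.cast (R := ℝ)) (Int.toNat_of_nonneg (by omega : 0 ≤ 2 * M + 1))
    have h4 : (V.card : ℝ) ≤ b * (2 * M + 1) ^ (d - 1) := by
      rw [← h3]
      exact_mod_cast h2
    refine h4.trans (mul_le_mul_of_nonneg_left (pow_le_pow_left₀ ?_ ?_ _) (Nat.cast_nonneg b))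
    · have : (0 : ℝ) ≤ M := by exact_mod_cast hM0
      linarith
    · have := Int.floor_le (A * R)
      rw [← hM] at this
      nlinarith
  have h5 := h1.trans (mul_le_mul hcard hdist (distInt_nonneg _) (by positivity))
  rw [mul_one_div, le_div_iff₀ (by positivity), one_mul] at h5
  have h6 : (R : ℝ) ^ d = R * R ^ (d - 1) := by
    rw [← pow_succ']
    congr 1
    omega
  push_cast at h5
  rw [h6, mul_pow, ← mul_assoc] at h5
  have h7 : (0 : ℝ) < R ^ (d - 1) := by positivity
  nlinarith [mul_lt_mul_of_pos_right hR h7]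

/-- In codimension one, linear repetitivity with respect to the aligned boxes yields a
multiplicatively badly approximable vector. -/
theorem IsCanonical.exists_littlewoodLiminf_pos (hd : 1 ≤ d) (hk : k = d + 1)
    (hD : D.IsCanonical) (hLR : D.IsLR (alignedBoxes d)) :
    ∃ α : Fin d → ℝ, 0 < littlewoodLiminf α := by
  obtain ⟨κ, hκ, hbox⟩ := hLR.exists_boxBound hd hD
  set i₁ : Fin k := ⟨d, by omega⟩ with hi₁
  obtain ⟨c, hc, h⟩ := simultaneous_of_dual hd (D.coef i₁) (c := 1 / κ) (by positivity) (by
    intro m hm p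
    obtain ⟨i, hi, hirr⟩ := hD.2.2.1.exists_irrational_form hm
    -- In codimension one there is a single form, so aperiodicity makes this very form irrational at
    -- every nonzero `m`.
    obtain rfl : i = i₁ := by
      ext
      simp only [hi₁]
      omega
    have h1 := hbox.one_le_distInt_form hi (distInt_ne_zero_of_irrational hirr)
    have h2 := distInt_le_abs_sub (D.form i₁ fun j => (m j : ℝ)) p
    rw [div_le_iff₀ hκ]
    refine h1.trans ?_
    have h3 : 0 ≤ ∏ j, max 1 |(m j : ℝ)| :=
      Finset.prod_nonneg fun j _ => le_max_of_le_left zero_le_one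
    have h4 := mul_le_mul_of_nonneg_left h2 (mul_nonneg hκ.le h3)
    refine h4.trans (le_of_eq ?_)
    rw [form]
    ring)
  exact ⟨_, littlewoodLiminf_pos_of_le hc h⟩

theorem form_pair (D : CutProject k d) (i : Fin k) (j₁ j₂ : Fin d) (x y : ℤ) :
    D.form i (fun l => ((Pi.single j₁ x + Pi.single j₂ y : Fin d → ℤ) l : ℝ)) =
      x * D.coef i j₁ + y * D.coef i j₂ := by
  rw [← form_single, ← form_single, ← form_add]
  congr 1
  funext l
  simp

/-- Under the Littlewood conjecture, a linear form of a repetitive set has only one irrational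
coefficient. -/
theorem BoxBound.col_eq_of_irrational (hL : LittlewoodConjecture) {κ : ℝ} (hκ : 0 < κ)
    (hbox : D.BoxBound κ) (hA : D.IsAperiodic) {i : Fin k} (hi : d ≤ i) {j₁ j₂ : Fin d}
    (h₁ : Irrational (D.coef i j₁)) (h₂ : Irrational (D.coef i j₂)) : j₁ = j₂ := by
  by_contra hne
  obtain ⟨c, hc, h⟩ := simultaneous_of_dual (d := 2) (by norm_num) ![D.coef i j₁, D.coef i j₂]
    (c := 1 / κ) (by positivity) (by
    intro m hm p
    set μ : Fin d → ℤ := Pi.single j₁ (m 0) + Pi.single j₂ (m 1) with hμ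
    have hμ1 : μ j₁ = m 0 := by simp [hμ, hne]
    have hμ2 : μ j₂ = m 1 := by simp [hμ, Ne.symm hne]
    have hμ0 : μ ≠ 0 := by
      intro h0
      apply hm
      funext l
      fin_cases l
      · simpa [h0] using hμ1.symm
      · simpa [h0] using hμ2.symm
    obtain ⟨i', hi', hirr⟩ := hA.exists_irrational_form hμ0
    -- Any other row has rational entries in columns `j₁` and `j₂`, hence a rational value at `μ`.
    have hii : i' = i := by
      by_contra hii
      have hr : ∀ j, Irrational (D.coef i j) → ∃ r : ℚ, (r : ℝ) = D.coef i' j := fun j hj =>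
        not_not.1 fun h => hii (hbox.eq_of_irrational hκ hi' hi h hj)
      obtain ⟨r₁, hr₁⟩ := hr j₁ h₁
      obtain ⟨r₂, hr₂⟩ := hr j₂ h₂
      apply hirr
      refine ⟨m 0 * r₁ + m 1 * r₂, ?_⟩
      rw [hμ, D.form_pair i', ← hr₁, ← hr₂]
      push_cast
      rfl
    subst hii
    have h1 := hbox.one_le_distInt_form hi' (distInt_ne_zero_of_irrational hirr)
    have h2 := distInt_le_abs_sub (D.form i' fun j => (μ j : ℝ)) p
    have h3 : ∏ j, max 1 |(μ j : ℝ)| = max 1 |(m 0 : ℝ)| * max 1 |(m 1 : ℝ)| := by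
      rw [← Finset.mul_prod_erase Finset.univ _ (Finset.mem_univ j₁),
        ← Finset.mul_prod_erase _ _ (Finset.mem_erase.2 ⟨Ne.symm hne, Finset.mem_univ j₂⟩),
        Finset.prod_eq_one, mul_one, hμ1, hμ2]
      intro l hl
      rw [Finset.mem_erase, Finset.mem_erase] at hl
      simp [hμ, hl.1, hl.2.1]
    rw [div_le_iff₀ hκ, Fin.prod_univ_two, Fin.sum_univ_two, ← h3]
    refine h1.trans ?_
    have h4 : 0 ≤ ∏ j, max 1 |(μ j : ℝ)| :=
      Finset.prod_nonneg fun j _ => le_max_of_le_left zero_le_one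
    refine (mul_le_mul_of_nonneg_left h2 (mul_nonneg hκ.le h4)).trans (le_of_eq ?_)
    rw [hμ, D.form_pair i']
    simp only [Matrix.cons_val_zero, Matrix.cons_val_one]
    rw [mul_comm (m 0 : ℝ), mul_comm (m 1 : ℝ)]
    ring)
  refine hL.not_two_le hc (α := D.coef i j₁) (β := D.coef i j₂) fun n hn => ?_
  simpa [Fin.prod_univ_two] using h n hn

/-- Under the Littlewood conjecture, repetitivity forces `k = 2 d`. -/
theorem BoxBound.eq_two_mul (hL : LittlewoodConjecture) {κ : ℝ} (hκ : 0 < κ)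
    (hbox : D.BoxBound κ) (hD : D.IsCanonical) : k = 2 * d := by
  have hrow : ∀ r : Fin (k - d), ∃ j, Irrational (D.coef ⟨d + r, by omega⟩ j) := fun r =>
    hD.2.1.exists_irrational (Nat.le_add_right d r)
  choose f hf using hrow
  -- Injectivity: a column has at most one irrational entry. Surjectivity: aperiodicity puts an
  -- irrational entry in each column, and a row has only one.
  have hbij : Function.Bijective f := by
    constructor
    · intro r r' hrr
      have h1 := hf r'
      rw [← hrr] at h1
      have := hbox.eq_of_irrational hκ (Nat.le_add_right d r) (Nat.le_add_right d r') (hf r) h1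
      ext
      simpa using this
    · intro j
      obtain ⟨i, hi, hirr⟩ := hD.2.2.1.exists_irrational_form (m := Pi.single j 1) (by simp)
      rw [form_single, Int.cast_one, one_mul] at hirr
      refine ⟨⟨i - d, by omega⟩, ?_⟩
      have h1 := hf ⟨i - d, by omega⟩
      have h2 : (⟨d + ((⟨i - d, by omega⟩ : Fin (k - d)) : ℕ), by simp; omega⟩ : Fin k) = i := by
        ext
        simp
        omega
      rw [h2] at h1
      exact hbox.col_eq_of_irrational hL hκ hD.2.2.1 hi h1 hirr
  have := Fintype.card_of_bijective hbij
  simp only [Fintype.card_fin] at this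
  have := D.d_le_k
  omega

/-- A canonical cut and project set has positive codimension. -/
theorem IsCanonical.lt (hd : 1 ≤ d) (hD : D.IsCanonical) : d < k := by
  obtain ⟨i, hi, -⟩ := hD.2.2.1.exists_irrational_form (m := Pi.single ⟨0, hd⟩ 1) (by simp)
  omega

end CutProject

end

/-! ### Canonical sets of codimension one. -/

noncomputable section

variable {d : ℕ}

/-- The linear functional whose kernel is the graph of the linear form with coefficients `α`. -/
def codimOneForm (α : Fin d → ℝ) : RSpace (d + 1) →ₗ[ℝ] ℝ where
  toFun z := z (Fin.last d) - ∑ j, α j * z (Fin.castSucc j)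
  map_add' x y := by
    simp only [PiLp.add_apply, mul_add, Finset.sum_add_distrib]
    ring
  map_smul' c x := by
    simp only [PiLp.smul_apply, smul_eq_mul, RingHom.id_apply, mul_sub, Finset.mul_sum]
    congr 1
    exact Finset.sum_congr rfl fun j _ => by ring

theorem codimOneForm_apply (α : Fin d → ℝ) (z : RSpace (d + 1)) :
    codimOneForm α z = z (Fin.last d) - ∑ j, α j * z (Fin.castSucc j) := rfl

theorem codimOneForm_glue (α : Fin d → ℝ) (x : Fin d → ℝ) (y : Fin (d + 1) → ℝ) :
    codimOneForm α (CutProject.glue x y) = y (Fin.last d) - ∑ j, α j * x j := by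
  simp [codimOneForm_apply, CutProject.glue]

theorem codimOneForm_of_mem (α : Fin d → ℝ) {z : RSpace (d + 1)}
    (hz : z ∈ refSubspace (d + 1) d) : codimOneForm α z = z (Fin.last d) := by
  rw [codimOneForm_apply, Finset.sum_eq_zero, sub_zero]
  intro j _
  rw [hz (Fin.castSucc j) j.2, mul_zero]

/-- The vertex of the unit cube where the functional is smallest. -/
def lowVertex (α : Fin d → ℝ) : RSpace (d + 1) :=
  CutProject.glue (fun j => ((if 0 < α j then 1 else 0 : ℤ) : ℝ)) fun _ => ((0 : ℤ) : ℝ)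

/-- The vertex of the unit cube where the functional is largest. -/
def highVertex (α : Fin d → ℝ) : RSpace (d + 1) :=
  CutProject.glue (fun j => ((if α j < 0 then 1 else 0 : ℤ) : ℝ)) fun _ => ((1 : ℤ) : ℝ)

theorem lowVertex_mem (α : Fin d → ℝ) : lowVertex α ∈ intLattice (d + 1) :=
  CutProject.glue_mem_intLattice _ _

theorem highVertex_mem (α : Fin d → ℝ) : highVertex α ∈ intLattice (d + 1) :=
  CutProject.glue_mem_intLattice _ _

theorem lowVertex_mem_unitCube (α : Fin d → ℝ) : lowVertex α ∈ unitCube (d + 1) := by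
  intro i
  simp only [lowVertex, CutProject.glue]
  split_ifs <;> norm_num

theorem highVertex_mem_unitCube (α : Fin d → ℝ) : highVertex α ∈ unitCube (d + 1) := by
  intro i
  simp only [highVertex, CutProject.glue]
  split_ifs <;> norm_num

theorem codimOneForm_low_le (α : Fin d → ℝ) {t : RSpace (d + 1)} (ht : t ∈ unitCube (d + 1)) :
    codimOneForm α (lowVertex α) ≤ codimOneForm α t := by
  rw [lowVertex, codimOneForm_glue, codimOneForm_apply]
  have h1 : ∑ j, α j * t (Fin.castSucc j) ≤
      ∑ j, α j * ((if 0 < α j then 1 else 0 : ℤ) : ℝ) := by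
    refine Finset.sum_le_sum fun j _ => ?_
    have := ht (Fin.castSucc j)
    split_ifs with hj
    · push_cast
      nlinarith
    · push_cast
      nlinarith
  have := (ht (Fin.last d)).1
  push_cast at h1 ⊢
  linarith

theorem codimOneForm_le_high (α : Fin d → ℝ) {t : RSpace (d + 1)} (ht : t ∈ unitCube (d + 1)) :
    codimOneForm α t ≤ codimOneForm α (highVertex α) := by
  rw [highVertex, codimOneForm_glue, codimOneForm_apply]
  have h1 : ∑ j, α j * ((if α j < 0 then 1 else 0 : ℤ) : ℝ) ≤
      ∑ j, α j * t (Fin.castSucc j) := by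
    refine Finset.sum_le_sum fun j _ => ?_
    have := ht (Fin.castSucc j)
    split_ifs with hj
    · push_cast
      nlinarith
    · push_cast
      nlinarith
  have := (ht (Fin.last d)).2
  push_cast at h1 ⊢
  linarith

theorem codimOneForm_image_unitCube (α : Fin d → ℝ) : codimOneForm α '' unitCube (d + 1) =
    Set.Icc (codimOneForm α (lowVertex α)) (codimOneForm α (highVertex α)) := by
  refine Set.Subset.antisymm ?_ ?_
  · rintro _ ⟨t, ht, rfl⟩
    exact ⟨codimOneForm_low_le α ht, codimOneForm_le_high α ht⟩
  · have hconv : Convex ℝ (unitCube (d + 1)) := by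
      intro x hx y hy a b ha hb hab i
      have h1 := hx i
      have h2 := hy i
      simp only [PiLp.add_apply, PiLp.smul_apply, smul_eq_mul]
      constructor <;> nlinarith
    exact hconv.isPreconnected.intermediate_value (lowVertex_mem_unitCube α)
      (highVertex_mem_unitCube α) (LinearMap.continuous_of_finiteDimensional _).continuousOn

theorem isCompl_ker_of_line {V : Type*} [AddCommGroup V] [Module ℝ V] (φ : V →ₗ[ℝ] ℝ)
    (F : Submodule ℝ V) (h1 : ∀ z ∈ F, φ z = 0 → z = 0) {f : V} (hf : f ∈ F) (h2 : φ f ≠ 0) :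
    IsCompl (LinearMap.ker φ) F := by
  constructor
  · rw [Submodule.disjoint_def]
    intro z hz hzF
    exact h1 z hzF (LinearMap.mem_ker.1 hz)
  · rw [codisjoint_iff_le_sup]
    intro z _
    refine Submodule.mem_sup.2 ⟨z - (φ z / φ f) • f, ?_, (φ z / φ f) • f, F.smul_mem _ hf,
      sub_add_cancel _ _⟩
    rw [LinearMap.mem_ker, map_sub, map_smul, smul_eq_mul, div_mul_cancel₀ _ h2, sub_self]

theorem codimOneForm_lastVector (α : Fin d → ℝ) :
    codimOneForm α (CutProject.glue (0 : Fin d → ℝ) fun _ => (1 : ℝ)) = 1 := by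
  simp [codimOneForm_glue]

theorem lastVector_mem : (CutProject.glue (0 : Fin d → ℝ) fun _ => (1 : ℝ)) ∈ refSubspace (d + 1) d := by
  intro i hi
  simp [CutProject.glue, hi]

theorem isCompl_ker_refSubspace (α : Fin d → ℝ) :
    IsCompl (LinearMap.ker (codimOneForm α)) (refSubspace (d + 1) d) := by
  refine isCompl_ker_of_line _ _ (fun z hz h0 => ?_) lastVector_mem
    (by rw [codimOneForm_lastVector]; exact one_ne_zero)
  rw [codimOneForm_of_mem α hz] at h0
  ext i
  rcases lt_or_ge i.val d with hi | hi
  · exact hz i hi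
  · have : i = Fin.last d := by
      ext
      simp
      omega
    rw [this]
    exact h0

theorem isCompl_ker_span (α : Fin d → ℝ) {f : RSpace (d + 1)} (hf : codimOneForm α f ≠ 0) :
    IsCompl (LinearMap.ker (codimOneForm α)) (Submodule.span ℝ {f}) := by
  refine isCompl_ker_of_line _ _ (fun z hz h0 => ?_) (Submodule.mem_span_singleton_self f) hf
  obtain ⟨c, rfl⟩ := Submodule.mem_span_singleton.1 hz
  rw [map_smul, smul_eq_mul, mul_eq_zero, or_iff_left hf] at h0
  rw [h0, zero_smul]

/-- The cut and project set of codimension one with physical space the graph of the linear form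
with coefficients `α`, projected along the line spanned by `f`. -/
def codimOneSet (α : Fin d → ℝ) (f : RSpace (d + 1)) (hf : codimOneForm α f ≠ 0)
    (hfL : ∀ c : ℝ, c • f ∈ intLattice (d + 1) → c = 0) (τ : ℝ) : CutProject (d + 1) d where
  E := LinearMap.ker (codimOneForm α)
  Fπ := Submodule.span ℝ {f}
  Wπ := {w | w ∈ Submodule.span ℝ {f} ∧ codimOneForm α w ∈ codimOneForm α '' unitCube (d + 1)}
  s := CutProject.glue (0 : Fin d → ℝ) fun _ => τ
  finrank_E := by
    have h1 := LinearMap.finrank_range_add_finrank_ker (codimOneForm α)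
    have h2 : LinearMap.range (codimOneForm α) = ⊤ := by
      rw [LinearMap.range_eq_top]
      exact LinearMap.surjective fun h => hf (by rw [h]; rfl)
    rw [h2, finrank_top, Module.finrank_self, finrank_euclideanSpace_fin] at h1
    omega
  compl_pi := isCompl_ker_span α hf
  compl_rho := isCompl_ker_refSubspace α
  window_subset := fun _ hw => hw.1
  injOn_pi := by
    intro n hn n' hn' h
    rw [← sub_eq_zero, ← map_sub, Submodule.projection_apply_eq_zero_iff] at h
    obtain ⟨c, hc⟩ := Submodule.mem_span_singleton.1 h
    have := hfL c (by rw [hc]; exact sub_mem hn hn')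
    rw [this, zero_smul] at hc
    exact (sub_eq_zero.1 hc.symm)

section

variable {α : Fin d → ℝ} {f : RSpace (d + 1)} (hf : codimOneForm α f ≠ 0)
  (hfL : ∀ c : ℝ, c • f ∈ intLattice (d + 1) → c = 0) (τ : ℝ)

theorem codimOneSet_mem_E {z : RSpace (d + 1)} :
    z ∈ (codimOneSet α f hf hfL τ).E ↔ codimOneForm α z = 0 := LinearMap.mem_ker

theorem codimOneSet_ρstar (z : RSpace (d + 1)) :
    (codimOneSet α f hf hfL τ).ρstar z (Fin.last d) = codimOneForm α z := by
  set D := codimOneSet α f hf hfL τ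
  have h1 := (codimOneSet_mem_E hf hfL τ).1 (D.ρ_mem z)
  rw [← codimOneForm_of_mem α (D.ρstar_mem z)]
  conv_rhs => rw [← D.ρ_add_ρstar z, map_add, h1, zero_add]

theorem codimOneSet_mem_strip {z : RSpace (d + 1)} : z ∈ (codimOneSet α f hf hfL τ).strip ↔
    codimOneForm α (lowVertex α) ≤ codimOneForm α z ∧
      codimOneForm α z ≤ codimOneForm α (highVertex α) := by
  rw [← Set.mem_Icc, ← codimOneForm_image_unitCube]
  constructor
  · rintro ⟨w, hw, e, he, rfl⟩
    rw [map_add, (codimOneSet_mem_E hf hfL τ).1 he, add_zero]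
    exact hw.2
  · intro hz
    set w := (codimOneForm α z / codimOneForm α f) • f with hw
    have hφ : codimOneForm α w = codimOneForm α z := by
      rw [hw, map_smul, smul_eq_mul, div_mul_cancel₀ _ hf]
    refine ⟨w, ⟨Submodule.smul_mem _ _ (Submodule.mem_span_singleton_self f), ?_⟩, z - w, ?_,
      add_sub_cancel _ _⟩
    · rwa [hφ]
    · rw [SetLike.mem_coe, codimOneSet_mem_E, map_sub, hφ, sub_self]

theorem codimOneSet_window : (codimOneSet α f hf hfL τ).window =
    (codimOneSet α f hf hfL τ).ρstar '' unitCube (d + 1) := by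
  set D := codimOneSet α f hf hfL τ with hD
  have hext : ∀ z w, codimOneForm α z = codimOneForm α w → D.ρstar z = D.ρstar w := by
    intro z w h
    rw [D.ρstar_eq_iff]
    intro i hi
    have : i = Fin.last d := by
      ext
      simp
      omega
    rw [this, hD, codimOneSet_ρstar, codimOneSet_ρstar, h]
  ext z
  constructor
  · rintro ⟨hz, hzF⟩
    rw [codimOneSet_mem_strip, ← Set.mem_Icc, ← codimOneForm_image_unitCube] at hz
    obtain ⟨t, ht, htz⟩ := hz
    refine ⟨t, ht, ?_⟩
    rw [hext t z htz, D.ρstar_of_mem hzF]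
  · rintro ⟨t, ht, rfl⟩
    refine ⟨?_, D.ρstar_mem t⟩
    rw [codimOneSet_mem_strip, codimOneForm_of_mem α (D.ρstar_mem t), hD, codimOneSet_ρstar]
    exact ⟨codimOneForm_low_le α ht, codimOneForm_le_high α ht⟩

theorem codimOneSet_form_s : codimOneForm α (codimOneSet α f hf hfL τ).s = τ := by
  simp [codimOneSet, codimOneForm_glue]

/-- On the boundary of the strip the functional takes its value at `lowVertex` or `highVertex`, both
lattice points; meeting the boundary would make `τ` a value of the functional on the lattice. -/
theorem codimOneSet_isRegular (hτ : ∀ n ∈ intLattice (d + 1), codimOneForm α n ≠ τ) :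
    (codimOneSet α f hf hfL τ).IsRegular := by
  intro n hn hfr
  have h1 : (codimOneSet α f hf hfL τ).strip = codimOneForm α ⁻¹'
      Set.Icc (codimOneForm α (lowVertex α)) (codimOneForm α (highVertex α)) := by
    ext z
    exact codimOneSet_mem_strip hf hfL τ
  rw [h1] at hfr
  have hcont : Continuous (codimOneForm α) := LinearMap.continuous_of_finiteDimensional _
  have h2 := hcont.frontier_preimage_subset _ hfr
  rw [frontier_Icc ((codimOneForm_low_le α (highVertex_mem_unitCube α)))] at h2
  rw [Set.mem_preimage, map_add, codimOneSet_form_s] at h2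
  rcases h2 with h2 | h2
  · refine hτ _ (sub_mem (lowVertex_mem α) hn) ?_
    rw [map_sub]
    linarith
  · refine hτ _ (sub_mem (highVertex_mem α) hn) ?_
    rw [map_sub]
    linarith [Set.mem_singleton_iff.1 h2]

/-- The functional grows at unit rate along the last coordinate axis, so density of its lattice
values makes `E + ℤ^(d+1)` dense. -/
theorem codimOneSet_isTotallyIrrational
    (hdense : ∀ γ δ : ℝ, 0 < δ → ∃ n ∈ intLattice (d + 1), |γ - codimOneForm α n| < δ) :
    (codimOneSet α f hf hfL τ).IsTotallyIrrational := by
  set D := codimOneSet α f hf hfL τ with hD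
  set S : Set (RSpace (d + 1)) := {z | ∃ n ∈ intLattice (d + 1), z - n ∈ D.E} with hS
  have hSd : Dense S := by
    rw [Metric.dense_iff]
    intro z δ hδ
    obtain ⟨n, hn, hnz⟩ := hdense (codimOneForm α z) δ hδ
    set v : RSpace (d + 1) := CutProject.glue (0 : Fin d → ℝ) fun _ => (1 : ℝ) with hv
    refine ⟨z - (codimOneForm α z - codimOneForm α n) • v, ?_, n, hn, ?_⟩
    · rw [mem_ball_iff_norm, sub_sub_cancel_left, norm_neg, norm_smul, Real.norm_eq_abs]
      have : ‖v‖ = 1 := by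
        have : v = EuclideanSpace.single (Fin.last d) 1 := by
          ext i
          rcases lt_or_ge i.val d with hi | hi
          · have : i ≠ Fin.last d := by
              intro h
              rw [h] at hi
              simp at hi
            simp [hv, CutProject.glue, hi, this]
          · have : i = Fin.last d := by
              ext
              simp
              omega
            subst this
            simp [hv, CutProject.glue]
        rw [this]
        simp
      rwa [this, mul_one]
    · rw [hD, codimOneSet_mem_E, map_sub, map_sub, map_smul, hv, codimOneForm_lastVector]
      simp
  have h1 := (QuotientAddGroup.mk_surjective (s := intLattice (d + 1))).denseRange.dense_image
    (continuous_quotient_mk') hSd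
  refine h1.mono ?_
  rintro _ ⟨z, ⟨n, hn, hz⟩, rfl⟩
  refine ⟨z - n, hz, ?_⟩
  rw [QuotientAddGroup.eq]
  simpa using hn

/-- A period lifts to a lattice vector `m` all of whose nonnegative multiples keep a point inside
the strip. The functional is bounded there, so it vanishes at `m`. -/
theorem codimOneSet_isAperiodic
    (hker : ∀ n ∈ intLattice (d + 1), codimOneForm α n = 0 → n = 0) :
    (codimOneSet α f hf hfL τ).IsAperiodic := by
  set D := codimOneSet α f hf hfL τ with hD
  intro x hx hper
  have hshift : ∀ y ∈ D.Y, y + x ∈ D.Y := fun y hy => by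
    rw [← hper]
    exact ⟨y, hy, rfl⟩
  obtain ⟨n, hn, hS⟩ : ∃ n ∈ intLattice (d + 1), n + D.s ∈ D.strip := by
    set p : ℤ := ⌈codimOneForm α (lowVertex α) - τ⌉ with hp
    refine ⟨CutProject.glue (fun j => (((0 : Fin d → ℤ) j : ℤ) : ℝ))
      fun i => (((fun _ => p : Fin (d + 1) → ℤ) i : ℤ) : ℝ), CutProject.glue_mem_intLattice _ _, ?_⟩
    rw [hD, codimOneSet_mem_strip, map_add, codimOneSet_form_s, codimOneForm_glue]
    have h1 := Int.le_ceil (codimOneForm α (lowVertex α) - τ)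
    have h2 := Int.ceil_lt_add_one (codimOneForm α (lowVertex α) - τ)
    -- The window contains the values at the origin and at the last basis vector, so it has length
    -- at least one and contains a suitable integer translate of `τ`.
    have h3 : codimOneForm α (lowVertex α) + 1 ≤ codimOneForm α (highVertex α) := by
      have h4 := codimOneForm_low_le α (t := CutProject.glue (0 : Fin d → ℝ) fun _ => (0 : ℝ)) (by
        intro i
        simp [CutProject.glue])
      have h5 := codimOneForm_le_high α (t := CutProject.glue (0 : Fin d → ℝ) fun _ => (1 : ℝ)) (by
        intro i
        simp only [CutProject.glue]
        split_ifs <;> simp)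
      rw [codimOneForm_glue] at h4 h5
      simp at h4 h5
      linarith
    simp only [Pi.zero_apply, Int.cast_zero, mul_zero, Finset.sum_const_zero, sub_zero]
    rw [← hp] at h1 h2
    constructor <;> linarith
  obtain ⟨n₁, hn₁, hS₁, hn₁x⟩ := D.mem_Y_iff.1 (hshift _ ((D.π_mem_Y_iff hn).2 hS))
  set m := n₁ - n with hm
  have hmL : m ∈ intLattice (d + 1) := sub_mem hn₁ hn
  have hmx : D.π m = x := by
    have : m = (n₁ + D.s) - (n + D.s) := by rw [hm]; abel
    rw [this, map_sub, hn₁x, add_sub_cancel_left]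
  have hiter : ∀ i : ℕ, (n + i • m) + D.s ∈ D.strip := by
    intro i
    have hL : ∀ i : ℕ, n + i • m ∈ intLattice (d + 1) := fun i => add_mem hn (nsmul_mem hmL i)
    rw [← D.π_mem_Y_iff (hL i)]
    induction i with
    | zero => simpa using (D.π_mem_Y_iff hn).2 hS
    | succ i ih =>
      have := hshift _ ih
      rw [← hmx, ← map_add] at this
      convert this using 2
      rw [succ_nsmul]
      abel
  have hφ : codimOneForm α m = 0 := by
    have hbd : ∀ i : ℕ, codimOneForm α (lowVertex α) ≤
        codimOneForm α n + i * codimOneForm α m + τ ∧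
        codimOneForm α n + i * codimOneForm α m + τ ≤ codimOneForm α (highVertex α) := by
      intro i
      have := hiter i
      rw [hD, codimOneSet_mem_strip, map_add, codimOneSet_form_s, map_add, map_nsmul,
        nsmul_eq_mul] at this
      exact this
    by_contra hne
    obtain ⟨i, hi⟩ := exists_nat_gt ((codimOneForm α (highVertex α) -
      codimOneForm α (lowVertex α)) / |codimOneForm α m|)
    rw [div_lt_iff₀ (abs_pos.2 hne)] at hi
    have h0 := hbd 0
    have h1 := hbd i
    simp only [Nat.cast_zero, zero_mul, add_zero] at h0
    rcases abs_cases (codimOneForm α m) with ⟨h2, -⟩ | ⟨h2, -⟩ <;> rw [h2] at hi <;> nlinarith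
  have hm0 := hker m hmL hφ
  rw [← hmx, hm0, map_zero]

end

end

/-! ### Badly approximable vectors give repetitive sets. -/

noncomputable section

variable {d : ℕ}

/-- A point outside a `δ`-separated set is an endpoint of an interval of length `δ / 2` avoiding
this set. -/
theorem exists_half_interval {S : Set ℝ} {w δ : ℝ}
    (hS : ∀ x ∈ S, ∀ y ∈ S, x ≠ y → δ ≤ |x - y|) (hw : w ∉ S) :
    ∃ γ : ℝ, ∀ w', |w' - γ| < δ / 4 → ∀ x ∈ S, (x ≤ w' ↔ x ≤ w) ∧ (w' ≤ x ↔ w ≤ x) := by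
  -- By separation, points of `S` cannot lie within `δ / 2` of `w` on both sides; `γ` is the
  -- midpoint of a free half.
  by_cases h : ∃ x ∈ S, w < x ∧ x < w + δ / 2
  · obtain ⟨x, hx, h1, h2⟩ := h
    refine ⟨w - δ / 4, fun w' hw' y hy => ?_⟩
    rw [abs_lt] at hw'
    have hyw : y ≠ w := fun h => hw (h ▸ hy)
    rcases lt_or_gt_of_ne hyw with hlt | hgt
    · have h3 : δ ≤ |x - y| := hS x hx y hy (by linarith : y < x).ne'
      rw [abs_of_pos (by linarith)] at h3
      constructor <;> constructor <;> intro <;> linarith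
    · constructor <;> constructor <;> intro <;> linarith
  · push Not at h
    refine ⟨w + δ / 4, fun w' hw' y hy => ?_⟩
    rw [abs_lt] at hw'
    have hyw : y ≠ w := fun h => hw (h ▸ hy)
    rcases lt_or_gt_of_ne hyw with hlt | hgt
    · constructor <;> constructor <;> intro <;> linarith
    · have := h y hy hgt
      constructor <;> constructor <;> intro <;> linarith

theorem norm_lt_of_forall_abs_le {x : RSpace d} {M r : ℝ} (hr : d * M < r)
    (hx : ∀ j, |x j| ≤ M) : ‖x‖ < r := by
  refine lt_of_le_of_lt ?_ hr
  calc ‖x‖ = ‖∑ j, EuclideanSpace.single j (x j)‖ := by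
        congr 1
        ext i
        simp [Finset.sum_apply, Pi.single_apply]
    _ ≤ ∑ j, ‖EuclideanSpace.single j (x j)‖ := norm_sum_le _ _
    _ ≤ ∑ _j : Fin d, M := Finset.sum_le_sum fun j _ => by simpa using hx j
    _ = d * M := by simp

/-- Values of a badly approximable form at lattice points over a box are separated. -/
theorem separated_codimOneForm {α : Fin d → ℝ} {c : ℝ} (hc1 : c ≤ 1)
    (h : ∀ m : Fin d → ℤ, m ≠ 0 → ∀ p : ℤ,
      c ≤ |∑ j, α j * m j - p| * ∏ j, max 1 |(m j : ℝ)|)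
    {N : Fin d → ℝ} (hN : ∀ j, 1 ≤ N j) {g : RSpace (d + 1)} (hg : g ∈ intLattice (d + 1))
    (hgN : ∀ j : Fin d, |g (Fin.castSucc j)| ≤ N j) (hne : codimOneForm α g ≠ 0) :
    c / ∏ j, N j ≤ |codimOneForm α g| := by
  choose p hp using hg
  have hP : (1 : ℝ) ≤ ∏ j, N j := by
    rw [← Finset.prod_const_one (s := (Finset.univ : Finset (Fin d)))]
    exact Finset.prod_le_prod (fun _ _ => zero_le_one) fun j _ => hN j
  set m : Fin d → ℤ := fun j => p (Fin.castSucc j) with hm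
  have e : codimOneForm α g = p (Fin.last d) - ∑ j, α j * m j := by
    rw [codimOneForm_apply, hp]
    simp only [hm, hp]
  rw [div_le_iff₀ (by linarith)]
  by_cases hm0 : m = 0
  · have h1 : codimOneForm α g = (p (Fin.last d) : ℝ) := by
      rw [e, hm0]
      simp
    rw [h1] at hne ⊢
    have h2 : (1 : ℝ) ≤ |(p (Fin.last d) : ℝ)| := by
      exact_mod_cast Int.one_le_abs (by exact_mod_cast hne)
    nlinarith
  · refine (h m hm0 (p (Fin.last d))).trans ?_
    rw [e, abs_sub_comm]
    refine mul_le_mul_of_nonneg_left (Finset.prod_le_prod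
      (fun j _ => le_max_of_le_left zero_le_one) fun j _ => max_le (hN j) ?_) (abs_nonneg _)
    have := hgN j
    rwa [hp] at this

theorem abs_castSucc_le {a b : Fin d → ℤ} {m m' l l' : RSpace (d + 1)} {j : Fin d}
    (hab : a j < b j)
    (hm : (a j : ℝ) ≤ m (Fin.castSucc j) ∧ m (Fin.castSucc j) ≤ b j)
    (hm' : (a j : ℝ) ≤ m' (Fin.castSucc j) ∧ m' (Fin.castSucc j) ≤ b j)
    (hl : l ∈ unitCube (d + 1)) (hl' : l' ∈ unitCube (d + 1)) :
    |((l - m) - (l' - m')) (Fin.castSucc j)| ≤ 2 * ((b j : ℝ) - a j) := by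
  have h1 := hl (Fin.castSucc j)
  have h2 := hl' (Fin.castSucc j)
  have h3 : (a j : ℝ) + 1 ≤ b j := by exact_mod_cast hab
  simp only [PiLp.sub_apply]
  rw [abs_le]
  constructor <;> linarith

/-- The codimension one set of a multiplicatively badly approximable linear form is linearly
repetitive with respect to the aligned boxes. -/
theorem codimOneSet_isLR (hd : 1 ≤ d) {α : Fin d → ℝ} {c : ℝ} (hc : 0 < c)
    (h : ∀ m : Fin d → ℤ, m ≠ 0 → ∀ p : ℤ,
      c ≤ |∑ j, α j * m j - p| * ∏ j, max 1 |(m j : ℝ)|)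
    {f : RSpace (d + 1)} (hf : codimOneForm α f ≠ 0)
    (hfL : ∀ c : ℝ, c • f ∈ intLattice (d + 1) → c = 0) {τ : ℝ}
    (hτ : ∀ n ∈ intLattice (d + 1), codimOneForm α n ≠ τ) :
    (codimOneSet α f hf hfL τ).IsLR (alignedBoxes d) := by
  wlog hc1 : c ≤ 1 generalizing c
  · exact this one_pos (fun m hm p => (not_le.1 hc1).le.trans (h m hm p)) le_rfl
  set D := codimOneSet α f hf hfL τ with hD
  obtain ⟨K, hK0, hK⟩ := D.exists_head_π_bound (codimOneSet_window hf hfL τ)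
  obtain ⟨t₀, ht₀⟩ := exists_inhomogeneous α hc h
  obtain ⟨v, hv, hball⟩ := exists_volume_ball_eq hd
  -- Chosen so that `R > G R₀` forces `t₀ / R^d < δ / 4`, where `δ = c / (2^d |Ω|)`.
  set G : ℝ := 4 * t₀ * 2 ^ d / c + 1 with hG
  have hG1 : 1 ≤ G := by
    have : 0 ≤ 4 * t₀ * 2 ^ d / c := by positivity
    linarith
  -- Deviations per coordinate: `K` from `π` against `ρ`, `1` from rounding `x`, and `t₀ (G + 1)`
  -- from the approximating vector `q`.
  set H₀ : ℝ := K + 1 + t₀ * (G + 1) with hH₀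
  have hH₀0 : 0 ≤ H₀ := by positivity
  -- The factor `d` passes from the coordinates to the Euclidean norm; the extra one makes the
  -- inequality strict.
  set H : ℝ := d * H₀ + 1 with hH
  have hH0 : 0 < H := by positivity
  refine ⟨v * H ^ d, by positivity, ?_⟩
  rintro _ ⟨a, b, hab, h0, rfl⟩ y hy x r hvol
  set P := ∏ j, ((b j : ℝ) - a j) with hP
  have hP1 : 1 ≤ P := one_le_prod_sub hab
  set R₀ := P ^ (1 / (d : ℝ)) with hR₀
  have hR₀d : R₀ ^ d = P := by
    rw [hR₀, ← Real.rpow_natCast, ← Real.rpow_mul (by positivity), one_div,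
      inv_mul_cancel₀ (by positivity), Real.rpow_one]
  have hR₀1 : 1 ≤ R₀ := Real.one_le_rpow hP1 (by positivity)
  have hr : r = H * R₀ := by
    rw [volume_alignedBox hab, ← ENNReal.ofReal_mul (by positivity)] at hvol
    have hpos : 0 < v * H ^ d * P := by positivity
    rcases le_or_gt r 0 with hr0 | hr0
    · rw [Metric.ball_eq_empty.2 hr0, MeasureTheory.measure_empty, eq_comm,
        ENNReal.ofReal_eq_zero] at hvol
      linarith
    · rw [hball x r hr0.le, ENNReal.ofReal_eq_ofReal_iff (by positivity) hpos.le, ← hR₀d,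
        mul_assoc, ← mul_pow] at hvol
      exact (pow_left_inj₀ hr0.le (by positivity) (by omega)).1 (mul_left_cancel₀ hv.ne' hvol)
  obtain ⟨n, hn, hnS, rfl⟩ := D.mem_Y_iff.1 hy
  rw [D.occursIn_iff hn]
  set w := codimOneForm α n + τ with hw
  set δ := c / ∏ j, (2 * ((b j : ℝ) - a j)) with hδ
  have hδP : δ = c / (2 ^ d * P) := by
    rw [hδ, Finset.prod_mul_distrib, Finset.prod_const, Finset.card_univ, Fintype.card_fin]
  have hδ0 : 0 < δ := by
    rw [hδP]
    positivity
  -- The thresholds: whether `n + m + s` lies in the strip depends on how `w` compares with the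
  -- values at `l - m` for the two extreme vertices `l`. Differences of thresholds are lattice
  -- values over a doubled box, hence separated by `δ`.
  set Br : Set ℝ := {β | ∃ m ∈ intLattice (d + 1), ∃ l ∈ intLattice (d + 1), l ∈ unitCube (d + 1) ∧
    (∀ j : Fin d, (a j : ℝ) ≤ m (Fin.castSucc j) ∧ m (Fin.castSucc j) ≤ b j) ∧
    codimOneForm α (l - m) = β} with hBr
  obtain ⟨γ, hγ⟩ := exists_half_interval (S := Br) (w := w) (δ := δ)
    (by
      rintro _ ⟨m, hm, l, hl, hlc, hma, rfl⟩ _ ⟨m', hm', l', hl', hlc', hma', rfl⟩ hne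
      rw [← map_sub]
      refine separated_codimOneForm hc1 h (fun j => ?_)
        (sub_mem (sub_mem hl hm) (sub_mem hl' hm'))
        (fun j => abs_castSucc_le (hab j) (hma j) (hma' j) hlc hlc') ?_
      · have h3 : (a j : ℝ) + 1 ≤ b j := by exact_mod_cast hab j
        linarith
      · rw [map_sub]
        exact sub_ne_zero.2 hne)
    (by
      rintro ⟨m, hm, l, hl, -, -, hlm⟩
      refine hτ (l - m - n) (sub_mem (sub_mem hl hm) hn) ?_
      rw [map_sub, hlm, hw]
      ring)
  set R : ℕ := ⌊G * R₀⌋₊ + 1 with hR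
  have hR_lt : G * R₀ < R := by
    rw [hR]
    push_cast
    exact Nat.lt_floor_add_one _
  have hR_le : (R : ℝ) ≤ (G + 1) * R₀ := by
    have := Nat.floor_le (show 0 ≤ G * R₀ by positivity)
    rw [hR]
    push_cast
    linarith
  have hRpow : t₀ / (R : ℝ) ^ d < δ / 4 := by
    have h1 : G * P < (R : ℝ) ^ d := by
      calc G * P ≤ G ^ d * P := by
            refine mul_le_mul_of_nonneg_right ?_ (by linarith)
            exact le_self_pow₀ hG1 (by omega)
        _ = (G * R₀) ^ d := by rw [mul_pow, hR₀d]
        _ < _ := pow_lt_pow_left₀ hR_lt (by positivity) (by omega)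
    have hRpos : (0 : ℝ) < (R : ℝ) ^ d := lt_trans (by positivity) h1
    rw [div_lt_iff₀ hRpos, hδP]
    have h2 : 4 * t₀ * 2 ^ d / c * P < (R : ℝ) ^ d := by
      refine lt_of_le_of_lt ?_ h1
      refine mul_le_mul_of_nonneg_right ?_ (by linarith)
      rw [hG]
      linarith
    have h3 := mul_lt_mul_of_pos_left h2 (show 0 < c / (2 ^ d * P) / 4 by positivity)
    refine lt_of_eq_of_lt ?_ h3
    field_simp
  set q₀ : Fin d → ℤ := fun j => ⌊x j⌋ with hq₀
  -- Searching around the integer point `q₀` near the centre of the ball, the inhomogeneous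
  -- principle brings the functional within `δ / 4` of `γ`.
  obtain ⟨q, p, hq, hqp⟩ := ht₀ R (by omega) (τ - γ - ∑ j, α j * q₀ j)
  set n' : RSpace (d + 1) := CutProject.glue (fun j => (((q₀ + q) j : ℤ) : ℝ))
    fun i => (((fun _ => p : Fin (d + 1) → ℤ) i : ℤ) : ℝ) with hn'
  have hn'L : n' ∈ intLattice (d + 1) := CutProject.glue_mem_intLattice _ _
  have hclose : |codimOneForm α n' + τ - γ| < δ / 4 := by
    refine lt_of_eq_of_lt ?_ (hqp.trans_lt hRpow)
    congr 1
    rw [hn', codimOneForm_glue]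
    simp only [Pi.add_apply]
    push_cast
    simp only [mul_add, Finset.sum_add_distrib]
    ring
  have hsame := hγ _ hclose
  have hequiv : ∀ m ∈ intLattice (d + 1),
      D.head m ∈ {x : RSpace d | ∀ i, (a i : ℝ) ≤ x i ∧ x i ≤ (b i : ℝ)} →
      (n' + m + D.s ∈ D.strip ↔ n + m + D.s ∈ D.strip) := by
    intro m hm hmΩ
    have h1 := (hsame _ ⟨m, hm, lowVertex α, lowVertex_mem α, lowVertex_mem_unitCube α, hmΩ,
      rfl⟩).1
    have h2 := (hsame _ ⟨m, hm, highVertex α, highVertex_mem α, highVertex_mem_unitCube α, hmΩ,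
      rfl⟩).2
    rw [map_sub] at h1 h2
    rw [hD, codimOneSet_mem_strip, codimOneSet_mem_strip, map_add, map_add, map_add, map_add,
      codimOneSet_form_s]
    refine and_congr ⟨fun h3 => ?_, fun h3 => ?_⟩ ⟨fun h3 => ?_, fun h3 => ?_⟩
    · linarith [h1.1 (by linarith)]
    · linarith [h1.2 (by linarith)]
    · linarith [h2.1 (by linarith)]
    · linarith [h2.2 (by linarith)]
  have hn'S : n' + D.s ∈ D.strip := by
    have := hequiv 0 (zero_mem _) (by
      intro j
      have := h0 j
      simp only [CutProject.head_apply, PiLp.zero_apply]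
      exact_mod_cast this)
    rw [add_zero, add_zero] at this
    exact this.2 hnS
  refine ⟨n', hn'L, hn'S, ?_, hequiv⟩
  rw [mem_ball_iff_norm]
  refine norm_lt_of_forall_abs_le (M := H₀ * R₀) ?_ fun j => ?_
  · rw [hr, hH]
    linarith
  · have h1 := hK _ hn'S j
    have h2 : D.head (n' + D.s) j = (q₀ j : ℝ) + q j := by
      rw [D.head_add, PiLp.add_apply]
      have h3 : D.head n' j = (((q₀ + q) j : ℤ) : ℝ) := D.head_glue _ _ j
      have h4 : D.head D.s j = 0 := D.head_glue 0 (fun _ => τ) j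
      rw [h3, h4]
      simp
    rw [h2] at h1
    have h5 := Int.floor_le (x j)
    have h6 := Int.lt_floor_add_one (x j)
    have h7 := hq j
    have h8 : (t₀ : ℝ) * R ≤ t₀ * ((G + 1) * R₀) :=
      mul_le_mul_of_nonneg_left hR_le (Nat.cast_nonneg _)
    have h9 : H₀ * R₀ = (K + 1) * R₀ + t₀ * ((G + 1) * R₀) := by
      rw [hH₀]
      ring
    have h10 : K + 1 ≤ (K + 1) * R₀ := le_mul_of_one_le_right (by linarith) hR₀1
    simp only [PiLp.sub_apply]
    simp only [hq₀] at h1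
    rw [abs_le] at h1 h7 ⊢
    constructor <;> linarith

/-- A multiplicatively badly approximable vector gives rise to a canonical cut and project set
of codimension one that is linearly repetitive with respect to the aligned boxes. -/
theorem exists_canonical_isLR (hd : 1 ≤ d) {α : Fin d → ℝ} (hα : 0 < littlewoodLiminf α) :
    ∃ D : CutProject (d + 1) d, D.IsCanonical ∧ D.IsLR (alignedBoxes d) := by
  obtain ⟨c₀, hc₀, hsim⟩ := exists_le_of_littlewoodLiminf_pos hα
  obtain ⟨c, hc, h⟩ := dual_of_simultaneous α hc₀ hsim
  have hker : ∀ n ∈ intLattice (d + 1), codimOneForm α n = 0 → n = 0 := by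
    intro n hn h0
    choose p hp using hn
    rw [codimOneForm_apply, hp] at h0
    simp only [hp] at h0
    have hm : (fun j : Fin d => p (Fin.castSucc j)) = 0 := by
      by_contra hm
      have h1 := h _ hm (p (Fin.last d))
      have h2 : ∑ j, α j * (p (Fin.castSucc j) : ℝ) - p (Fin.last d) = 0 := by linarith
      rw [h2, abs_zero, zero_mul] at h1
      linarith
    have hm' : ∀ j : Fin d, p (Fin.castSucc j) = 0 := fun j => congrFun hm j
    have hlast : (p (Fin.last d) : ℝ) = 0 := by
      simp only [hm', Int.cast_zero, mul_zero, Finset.sum_const_zero, sub_zero] at h0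
      exact h0
    ext i
    refine Fin.lastCases ?_ (fun j => ?_) i
    · rw [hp, hlast]
      rfl
    · rw [hp, hm' j]
      simp
  set j₀ : Fin d := ⟨0, hd⟩ with hj₀
  have hirr : Irrational (α j₀) := by
    rintro ⟨r, hr⟩
    have h1 := hsim r.den r.den_pos
    have h2 : distInt (r.den * α j₀) = 0 := by
      rw [distInt_eq_zero_iff]
      refine ⟨r.num, ?_⟩
      rw [← hr]
      exact_mod_cast Rat.den_mul_eq_num r
    rw [Finset.prod_eq_zero (Finset.mem_univ j₀) h2, mul_zero] at h1
    linarith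
  -- The functional at `f` is `1 - α_{j₀}²`, nonzero by irrationality. The two coordinates `1` and
  -- `α_{j₀}` are incommensurable, so the line meets the lattice only at zero.
  set f : RSpace (d + 1) := CutProject.glue (Pi.single j₀ (α j₀)) fun _ => (1 : ℝ) with hfdef
  have hf : codimOneForm α f ≠ 0 := by
    have h1 : codimOneForm α f = 1 - α j₀ * α j₀ := by
      rw [hfdef, codimOneForm_glue, Finset.sum_eq_single j₀]
      · simp
      · intro j _ hj
        simp [hj]
      · simp
    rw [h1]
    intro h0
    rcases mul_self_eq_one_iff.1 (by linarith : α j₀ * α j₀ = 1) with h2 | h2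
    · exact hirr.ne_one h2
    · exact hirr.ne_int (-1) (by rw [h2]; simp)
  have hfL : ∀ c : ℝ, c • f ∈ intLattice (d + 1) → c = 0 := by
    intro c hcf
    obtain ⟨p, hp⟩ := hcf (Fin.last d)
    obtain ⟨p', hp'⟩ := hcf (Fin.castSucc j₀)
    have h1 : f (Fin.last d) = 1 := by simp [hfdef, CutProject.glue]
    have h2 : f (Fin.castSucc j₀) = α j₀ := by simp [hfdef, CutProject.glue]
    rw [PiLp.smul_apply, smul_eq_mul, h1, mul_one] at hp
    rw [PiLp.smul_apply, smul_eq_mul, h2, hp] at hp'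
    by_contra hc0
    have hp0 : p ≠ 0 := by
      rintro rfl
      simp at hp
      exact hc0 hp
    exact (hirr.intCast_mul hp0).ne_int p' hp'
  obtain ⟨τ, hτ⟩ : ∃ τ : ℝ, ∀ n ∈ intLattice (d + 1), codimOneForm α n ≠ τ := by
    -- The forbidden values of `τ` are the countably many values on the lattice.
    have hcount : (codimOneForm α '' (intLattice (d + 1) : Set (RSpace (d + 1)))).Countable := by
      refine Set.Countable.image ?_ _
      refine (Set.countable_range fun p : Fin (d + 1) → ℤ =>
        (WithLp.toLp 2 fun i => (p i : ℝ) : RSpace (d + 1))).mono ?_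
      intro n hn
      choose p hp using hn
      refine ⟨p, ?_⟩
      ext i
      exact (hp i).symm
    have hne : codimOneForm α '' (intLattice (d + 1) : Set (RSpace (d + 1))) ≠ Set.univ := by
      intro h1
      rw [h1] at hcount
      exact Set.not_countable_univ hcount
    obtain ⟨τ, hτ⟩ := (Set.ne_univ_iff_exists_notMem _).1 hne
    exact ⟨τ, fun n hn h1 => hτ ⟨n, hn, h1⟩⟩
  refine ⟨codimOneSet α f hf hfL τ, ⟨codimOneSet_isRegular hf hfL τ hτ,
    codimOneSet_isTotallyIrrational hf hfL τ ?_, codimOneSet_isAperiodic hf hfL τ hker,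
    codimOneSet_window hf hfL τ⟩, codimOneSet_isLR hd hc h hf hfL hτ⟩
  intro γ δ hδ
  -- Density of the lattice values follows by letting `R` grow.
  obtain ⟨t₀, ht₀⟩ := exists_inhomogeneous α hc h
  obtain ⟨R, hR⟩ := exists_nat_gt (t₀ / δ)
  obtain ⟨q, p, -, hqp⟩ := ht₀ (R + 1) (by omega) (-γ)
  refine ⟨CutProject.glue (fun j => (q j : ℝ)) fun i => (((fun _ => p : Fin (d + 1) → ℤ) i : ℤ) : ℝ),
    CutProject.glue_mem_intLattice _ _, ?_⟩
  rw [codimOneForm_glue]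
  have h1 : (t₀ : ℝ) / ((R + 1 : ℕ) : ℝ) ^ d < δ := by
    rw [div_lt_iff₀ (by positivity)]
    rw [div_lt_iff₀ hδ] at hR
    have h2 : ((R + 1 : ℕ) : ℝ) ≤ ((R + 1 : ℕ) : ℝ) ^ d :=
      le_self_pow₀ (by push_cast; linarith [Nat.cast_nonneg (α := ℝ) R]) (by omega)
    push_cast at h2 ⊢
    nlinarith
  refine lt_of_eq_of_lt ?_ (hqp.trans_lt h1)
  rw [← abs_neg]
  congr 1
  ring

end

theorem theorem1p8 :
    (∀ k d : ℕ, 1 ≤ d → d < k →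
      (d + 1 < k → ¬ ∃ D : CutProject k d, D.IsCanonical ∧ D.IsLR (alignedBoxes d)) ∧
      (k = d + 1 →
        ((∃ D : CutProject k d, D.IsCanonical ∧ D.IsLR (alignedBoxes d)) ↔
          ∃ α : Fin d → ℝ, 0 < littlewoodLiminf α))) ∧
    (LittlewoodConjecture → ∀ k d : ℕ, 1 ≤ d → (k, d) ≠ (2, 1) →
      ¬ ∃ D : CutProject k d, D.IsCanonical ∧ D.IsLR (alignedBoxes d)) ∧
    (LittlewoodConjecture → ∀ k d : ℕ, 1 ≤ d → k ≠ 2 * d →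
      ¬ ∃ D : CutProject k d, D.IsCanonical ∧ D.IsLROmega (alignedBoxes d)) := by
  refine ⟨fun k d hd _ => ⟨?_, ?_⟩, ?_, ?_⟩
  · rintro hk ⟨D, hD, hLR⟩
    exact hD.not_isLR_of_lt hd hk hLR
  · intro hk
    constructor
    · rintro ⟨D, hD, hLR⟩
      exact hD.exists_littlewoodLiminf_pos hd hk hLR
    · rintro ⟨α, hα⟩
      subst hk
      exact exists_canonical_isLR hd hα
  · rintro hL k d hd hkd ⟨D, hD, hLR⟩
    have hlt := hD.lt hd
    rcases Nat.lt_or_ge (d + 1) k with hk | hk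
    · exact hD.not_isLR_of_lt hd hk hLR
    · have hk' : k = d + 1 := by omega
      obtain ⟨α, hα⟩ := hD.exists_littlewoodLiminf_pos hd hk' hLR
      refine hL.littlewoodLiminf_nonpos ?_ α hα
      by_contra hd2
      exact hkd (by rw [Prod.mk.injEq]; omega)
  · rintro hL k d _ hkd ⟨D, hD, hLR⟩
    obtain ⟨κ, hκ, hbox⟩ := hLR.exists_boxBound hD
    exact hkd (hbox.eq_two_mul hL hκ hD)
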